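/- A random tensor network (RTN) consists of a finite connected undirected graph with vertex set $V$ and internal edge set $E$ (no loops, parallel edges allowed), together with a finite set $P$ of $n=|P|$ external edges, each attached to one vertex. Every external edge has dimension $a\ge 1$, an internal edge $e$ has bond dimension $b_e\ge 1$, and every vertex $v$ carries one logical leg of dimension $d_v\ge 1$. The Hilbert space of the tensor at $v$ is the tensor product over all legs at $v$; its dimension is $q_v=a^{n_v}\,d_v\prod_{e\ni v}b_e$, where $n_v$ is the number of external edges at $v$. Choose a unit vector $|0_v\rangle$ in each of these spaces and independent Haar-random unitaries $U_v$, and put $|\psi_v\rangle=U_v|0_v\rangle$. For a bulk state vector $|\Phi\rangle\in\bigotimes_v\mathbb C^{d_v}$ the RTN state is $$|\psi\rangle=\langle\Phi|\bigotimes_{e\in E}\langle \mathrm{EPR}_e|\bigotimes_{v\in V}|\psi_v\rangle\in(\mathbb C^a)^{\otimes n},\qquad |\mathrm{EPR}_e\rangle=\sum_{i=1}^{b_e}|i\,i\rangle ,$$ and for a boundary reference state vector $|\phi\rangle\in(\mathbb C^a)^{\otimes n}$ the effective dimension $D_{\mathrm{eff}}$ is defined by $$\frac1{D_{\mathrm{eff}}}=a^n\,\frac{\mathbb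 E\big[|\langle\psi|\phi\rangle|^4\big]}{\big(\mathbb E[\langle\psi|\psi\rangle]\big)^2}.$$ A state vector is called unentangled if it is a tensor product of unit vectors, one for each vertex (for $\Phi$) or for each external edge (for $\phi$). Let $j\ne k$ be two vertices joined by an internal edge of bond dimension greater than $1$, and let $b_{jk}$ be the product of the bond dimensions of all internal edges joining $j$ and $k$. Fusing $j$ and $k$ means to replace them by a single vertex that carries all external edges of $j$ and $k$, all internal edges of $j$ and $k$ other than those joining $j$ and $k$, and a logical leg of dimension $d_jd_k$; everything else is unchanged. The result is an RTN with $|V|-1$ vertices in which exactly the internal edges joining $j$ and $k$ have been removed (so it has $|E|-1$ internal edges if $j$ and $k$ are joined by one edge), and whose fused tensor has dimension $q_jq_k/b_{jk}^2$. If the bulk and the boundary reference state vectors of both networks are unentangled, then, for any choice of the vectors $|0_v\rangle$, the effective dimensions $D_{\mathrm{eff}}$ of the original and $D'_{\mathrm{eff}}$ of the fused network satisfy $$0<D_{\mathrm{eff}}<D'_{\mathrm{eff}} .$$ -/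

import Mathlib

open MeasureTheory

noncomputable section

/-- The Borel σ-algebra on the unitary group. -/
instance unitaryGroupMeasurableSpace (n : Type*) [Fintype n] [DecidableEq n] :
    MeasurableSpace (Matrix.unitaryGroup n ℂ) := borel _

instance unitaryGroupBorelSpace (n : Type*) [Fintype n] [DecidableEq n] :
    BorelSpace (Matrix.unitaryGroup n ℂ) := ⟨rfl⟩

instance unitaryGroupCompactSpace (n : Type*) [Fintype n] [DecidableEq n] :
    CompactSpace (Matrix.unitaryGroup n ℂ) := by
  suffices h : IsCompact (Matrix.unitaryGroup n ℂ : Set (Matrix n n ℂ)) from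
    isCompact_iff_compactSpace.mp h
  have hK : IsCompact (Set.univ.pi fun _ : n => Set.univ.pi fun _ : n =>
      Metric.closedBall (0 : ℂ) 1) :=
    isCompact_univ_pi fun _ => isCompact_univ_pi fun _ => isCompact_closedBall _ _
  refine IsCompact.of_isClosed_subset (X := n → n → ℂ) hK ?_ ?_
  · have : IsClosed {A : Matrix n n ℂ | star A * A = 1 ∧ A * star A = 1} :=
      (isClosed_eq (by fun_prop) continuous_const).inter
        (isClosed_eq (by fun_prop) continuous_const)
    exact this
  · intro A hA i _ j _
    simpa using entry_norm_bound_of_unitary (𝕜 := ℂ) hA i j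

/-- The Haar probability measure on the unitary group `U(n)`. -/
def haarUnitary (n : Type*) [Fintype n] [DecidableEq n] : Measure (Matrix.unitaryGroup n ℂ) :=
  Measure.haarMeasure ⊤

/-- The combinatorial data of a random tensor network: a finite connected undirected graph with
vertices `V`, internal edges `E` (parallel edges are allowed, loops are not) and external edges `P`,
the physical sites; `site p` is the vertex that carries the external edge `p`. Every external edge
has dimension `physDim`, the internal edge `e` has dimension `bondDim e`, and the
vertex `v` carries one logical leg of dimension `logDim v`. -/
structure RTN (V E P : Type*) where
  ends : E → Sym2 V
  site : P → V
  physDim : ℕ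
  bondDim : E → ℕ
  logDim : V → ℕ
  not_loop : ∀ e, ¬ (ends e).IsDiag
  connected : (SimpleGraph.fromEdgeSet (Set.range ends)).Connected
  physDim_pos : 0 < physDim
  bondDim_pos : ∀ e, 0 < bondDim e
  logDim_pos : ∀ v, 0 < logDim v

/-- Unentangled unit vectors of `⨂ i, ℂ^(d i)`: tensor products of unit vectors. -/
def IsUnentangled {ι : Type*} [Fintype ι] {d : ι → ℕ}
    (Φ : EuclideanSpace ℂ (∀ i, Fin (d i))) : Prop :=
  ∃ f : ∀ i, EuclideanSpace ℂ (Fin (d i)), (∀ i, ‖f i‖ = 1) ∧ ∀ l, Φ l = ∏ i, f i (l i)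

namespace RTN

variable {V E P : Type*} [Fintype V] [DecidableEq V] [Fintype E] [DecidableEq E]
  [Fintype P] [DecidableEq P]

/-- Basis labels of the Hilbert space of the tensor at `v`: one label for each physical leg at `v`,
one for each internal leg at `v`, and one for the logical leg. -/
abbrev Legs (N : RTN V E P) (v : V) : Type _ :=
  ({p : P // N.site p = v} → Fin N.physDim) ×
    (∀ e : {e : E // v ∈ N.ends e}, Fin (N.bondDim e.1)) × Fin (N.logDim v)

/-- The total dimension `q_v` of the tensor at `v`. -/
def totalDim (N : RTN V E P) (v : V) : ℕ :=
  N.physDim ^ Fintype.card {p : P // N.site p = v} * N.logDim v *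
    ∏ e : {e : E // v ∈ N.ends e}, N.bondDim e.1

/-- The tensor network state `⟨Φ| ⨂_e ⟨EPR_e| ⨂_v |ψ_v⟩` with `|ψ_v⟩ = U_v |0_v⟩`: contraction with
the (unnormalized) EPR pair of an internal edge `e` is summation over a common label `i e` of its
two legs. -/
def state (N : RTN V E P) (Φ : EuclideanSpace ℂ (∀ v, Fin (N.logDim v)))
    (ref : ∀ v, EuclideanSpace ℂ (N.Legs v))
    (U : ∀ v, Matrix.unitaryGroup (N.Legs v) ℂ) : EuclideanSpace ℂ (P → Fin N.physDim) :=
  WithLp.toLp 2 fun x =>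
    ∑ l : ∀ v, Fin (N.logDim v), ∑ i : ∀ e, Fin (N.bondDim e),
      star (Φ l) * ∏ v, ((U v : Matrix (N.Legs v) (N.Legs v) ℂ).mulVec (ref v).ofLp)
        (fun p => x p.1, fun e => i e.1, l v)

/-- The law of the independent Haar-random unitaries, one for each vertex. -/
def law (N : RTN V E P) : Measure (∀ v, Matrix.unitaryGroup (N.Legs v) ℂ) :=
  Measure.pi fun v => haarUnitary (N.Legs v)

/-- The effective dimension, `1 / D_eff = a ^ n * 𝔼[|⟨ψ|φ⟩|^4] / (𝔼[⟨ψ|ψ⟩])^2`. -/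
def effDim (N : RTN V E P) (Φ : EuclideanSpace ℂ (∀ v, Fin (N.logDim v)))
    (φ : EuclideanSpace ℂ (P → Fin N.physDim))
    (ref : ∀ v, EuclideanSpace ℂ (N.Legs v)) : ℝ :=
  ((N.physDim : ℝ) ^ Fintype.card P *
    (∫ U, ‖inner ℂ (N.state Φ ref U) φ‖ ^ 4 ∂N.law) /
      (∫ U, ‖N.state Φ ref U‖ ^ 2 ∂N.law) ^ 2)⁻¹

/-- The total bond dimension between `j` and `k`, i.e. the product over all
internal edges that join them. -/
def bondDimBetween (N : RTN V E P) (j k : V) : ℕ :=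
  ∏ e : {e : E // N.ends e = s(j, k)}, N.bondDim e.1

/-- The vertex map of the fusion of `k` into `j`: it sends `k` to `j` and fixes the other vertices.
The fused vertex is represented by `j`. -/
def fuseMap {V : Type*} [DecidableEq V] {j k : V} (hjk : j ≠ k) (v : V) : {v : V // v ≠ k} :=
  if h : v = k then ⟨j, hjk⟩ else ⟨v, h⟩

lemma fuseMap_eq {V : Type*} [DecidableEq V] {j k : V} (hjk : j ≠ k) {x y : V} (hxy : x ≠ y)
    (h : fuseMap hjk x = fuseMap hjk y) : s(x, y) = s(j, k) := by
  unfold fuseMap at h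
  split_ifs at h <;> simp_all

lemma fuseMap_surjective {V : Type*} [DecidableEq V] {j k : V} (hjk : j ≠ k) :
    Function.Surjective (fuseMap hjk) := fun v => ⟨v.1, by simp [fuseMap, v.2]⟩

lemma fuse_connected {V E P : Type*} [DecidableEq V] (N : RTN V E P) {j k : V} (hjk : j ≠ k) :
    (SimpleGraph.fromEdgeSet (Set.range fun e : {e : E // N.ends e ≠ s(j, k)} =>
      (N.ends e.1).map (fuseMap hjk))).Connected := by
  have key : ∀ x y, (SimpleGraph.fromEdgeSet (Set.range N.ends)).Walk x y →
      (SimpleGraph.fromEdgeSet (Set.range fun e : {e : E // N.ends e ≠ s(j, k)} =>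
        (N.ends e.1).map (fuseMap hjk))).Reachable (fuseMap hjk x) (fuseMap hjk y) := by
    intro x y w
    induction w with
    | nil => exact SimpleGraph.Reachable.refl _
    | @cons u v w h p ih =>
      refine SimpleGraph.Reachable.trans ?_ ih
      rw [SimpleGraph.fromEdgeSet_adj] at h
      obtain ⟨⟨e, he⟩, huv⟩ := h
      by_cases hf : fuseMap hjk u = fuseMap hjk v
      · rw [hf]
      · refine SimpleGraph.Adj.reachable ?_
        rw [SimpleGraph.fromEdgeSet_adj]
        refine ⟨⟨⟨e, ?_⟩, ?_⟩, hf⟩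
        · intro h'
          rw [he, Sym2.eq_iff] at h'
          apply hf
          rcases h' with ⟨rfl, rfl⟩ | ⟨rfl, rfl⟩ <;> simp [fuseMap, hjk]
        · simp [he]
  have : Nonempty {v : V // v ≠ k} := ⟨⟨j, hjk⟩⟩
  refine ⟨fun x y => ?_⟩
  obtain ⟨x, rfl⟩ := fuseMap_surjective hjk x
  obtain ⟨y, rfl⟩ := fuseMap_surjective hjk y
  obtain ⟨w⟩ := N.connected.preconnected x y
  exact key x y w

/-- Fusion of two vertices `j` and `k`: they are replaced by one vertex (represented by `j`), which
carries all physical legs of both, all internal edges of both other than the edges that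
join `j` and `k`, and a logical leg of dimension `d_j * d_k`. -/
def fuse {V E P : Type*} [DecidableEq V] (N : RTN V E P) {j k : V} (hjk : j ≠ k) :
    RTN {v : V // v ≠ k} {e : E // N.ends e ≠ s(j, k)} P where
  ends e := (N.ends e.1).map (fuseMap hjk)
  site p := fuseMap hjk (N.site p)
  physDim := N.physDim
  bondDim e := N.bondDim e.1
  logDim v := if v.1 = j then N.logDim j * N.logDim k else N.logDim v.1
  not_loop := by
    have key : ∀ z : Sym2 V, z ≠ s(j, k) → ¬ z.IsDiag → ¬ (z.map (fuseMap hjk)).IsDiag := by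
      intro z
      induction z with
      | _ x y =>
        intro he hl h
        simp only [Sym2.map_mk, Sym2.mk_isDiag_iff] at h hl
        exact he (fuseMap_eq hjk hl h)
    exact fun e => key _ e.2 (N.not_loop e.1)
  connected := N.fuse_connected hjk
  physDim_pos := N.physDim_pos
  bondDim_pos e := N.bondDim_pos e.1
  logDim_pos v := by
    split_ifs
    · exact Nat.mul_pos (N.logDim_pos j) (N.logDim_pos k)
    · exact N.logDim_pos v.1

end RTN

end

noncomputable section

/-! ### Second and fourth moments of a Haar-random unit vector. -/

section HaarMoments

open ComplexConjugate

variable {n : Type*} [Fintype n] [DecidableEq n]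

/-! The effective dimension can be computed exactly. The fourth moment of a Haar-random unit vector
in dimension `q` is the sum of the two pairings of indices divided by `q (q + 1)` (`haarMoment_eq`).
Multiplying over the vertices gives one choice of pairing per vertex, that is, a spin configuration
`σ : V → Bool`. Contracting the labels with unentangled vectors gives weight 1 for either spin, so
there is no external field. An internal edge of dimension `b` gives `b ^ 2` for equal spins at its
ends and `b` for opposite ones. After normalization (`effDim_eq`), `1 / D_eff = a ^ (-n) * ∏ q_v /
(q_v + 1) * Z`, where the Ising sum `Z` gives each cut edge the weight `1 / b_e`.

It remains to see that fusion strictly lowers `∏ q_v / (q_v + 1) * Z`. Let `B` be the bond dimension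
between `j` and `k`, and write `q_j = x B`, `q_k = y B`; the fused tensor has dimension `x y`.
Splitting by whether the spins at `j` and `k` agree gives `Z = S + T / B`, while `Z' = S`, since
fusion forces agreement. The claim follows from `B > 1` and `(x + y) S ≤ (x y + 1) T`
(`alignedSum_le`). The latter says that alignment is not favoured too strongly by the other edges:
flipping the spin at `j` changes their weight by a factor of at most `x`, and at `k` by at most `y`.
-/

instance haarUnitaryIsProbabilityMeasure : IsProbabilityMeasure (haarUnitary n) :=
  ⟨Measure.haarMeasure_self (K₀ := ⊤)⟩

instance haarUnitaryIsMulLeftInvariant : (haarUnitary n).IsMulLeftInvariant := by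
  unfold haarUnitary; infer_instance

lemma integrable_haarUnitary_of_continuous {f : Matrix.unitaryGroup n ℂ → ℂ} (hf : Continuous f) :
    Integrable f (haarUnitary n) :=
  hf.integrable_of_hasCompactSupport (HasCompactSupport.of_compactSpace f)

@[fun_prop]
lemma continuous_unitary_mulVec_apply (w : n → ℂ) (a : n) :
    Continuous fun U : Matrix.unitaryGroup n ℂ => ((U : Matrix n n ℂ).mulVec w) a := by
  simp only [Matrix.mulVec, dotProduct]
  exact continuous_finsetSum _ fun i _ =>
    (continuous_subtype_val.matrix_elem a i).mul continuous_const

/-- The fourth moments `𝔼[ψ_a ψ_b conj ψ_c conj ψ_d]` of the random vector `ψ = U w`. -/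
def haarMoment (w : n → ℂ) (a b c d : n) : ℂ :=
  ∫ U, ((U : Matrix n n ℂ).mulVec w a * (U : Matrix n n ℂ).mulVec w b) *
    (conj ((U : Matrix n n ℂ).mulVec w c) * conj ((U : Matrix n n ℂ).mulVec w d)) ∂(haarUnitary n)

lemma haarMoment_right_comm (w : n → ℂ) (a b c d : n) :
    haarMoment w a b d c = haarMoment w a b c d := by
  unfold haarMoment
  congr 1; ext U; ring

lemma haarMoment_mul_left (w : n → ℂ) (A : Matrix.unitaryGroup n ℂ) (a b c d : n) :
    haarMoment w a b c d = ∫ U, ((A : Matrix n n ℂ).mulVec ((U : Matrix n n ℂ).mulVec w) a *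
      (A : Matrix n n ℂ).mulVec ((U : Matrix n n ℂ).mulVec w) b) *
      (conj ((A : Matrix n n ℂ).mulVec ((U : Matrix n n ℂ).mulVec w) c) *
        conj ((A : Matrix n n ℂ).mulVec ((U : Matrix n n ℂ).mulVec w) d)) ∂(haarUnitary n) := by
  unfold haarMoment
  rw [← integral_mul_left_eq_self _ A]
  simp [Matrix.mulVec_mulVec]

/-- Invariance under diagonal unitaries makes unpaired moments vanish. -/
lemma haarMoment_eq_zero (w : n → ℂ) {a b c d : n} (h₁ : ¬ (a = c ∧ b = d))
    (h₂ : ¬ (a = d ∧ b = c)) : haarMoment w a b c d = 0 := by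
  -- The phase at coordinate `s` is `I` and not `-1`: for `a = b` with `a` different from `c` and
  -- `d`, the phase enters squared, and `-1` would be invisible.
  have key : ∀ s : n, haarMoment w a b c d =
      (((if a = s then Complex.I else 1) * (if b = s then Complex.I else 1)) *
        (conj (if c = s then Complex.I else 1) * conj (if d = s then Complex.I else 1))) *
        haarMoment w a b c d := by
    intro s
    let A : Matrix.unitaryGroup n ℂ :=
      ⟨Matrix.diagonal fun i => if i = s then Complex.I else 1, by
        rw [Matrix.mem_unitaryGroup_iff, Matrix.star_eq_conjTranspose,
          Matrix.diagonal_conjTranspose, Matrix.diagonal_mul_diagonal, ← Matrix.diagonal_one]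
        congr 1
        ext i
        by_cases h : i = s <;> simp [h]⟩
    conv_lhs => rw [haarMoment_mul_left w A]
    unfold haarMoment
    rw [← integral_const_mul]
    congr 1
    ext U
    simp only [A, Matrix.mulVec_diagonal, map_mul]
    ring
  have hI : ∀ {z : ℂ}, haarMoment w a b c d = z * haarMoment w a b c d → z ≠ 1 →
      haarMoment w a b c d = 0 := by
    intro z hz hz1
    by_contra h
    exact hz1 (mul_right_cancel₀ h (by rw [one_mul]; exact hz.symm))
  have hI1 : Complex.I ≠ 1 := fun h => by simpa using congrArg Complex.im h
  by_cases hac : a = c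
  · subst hac
    have hbd : b ≠ d := fun h => h₁ ⟨rfl, h⟩
    refine hI (key b) ?_
    by_cases hab : a = b
    · simpa [hab, hbd.symm] using hI1
    · simpa [hab, hbd.symm] using hI1
  · by_cases had : a = d
    · subst had
      have hbc : b ≠ c := fun h => h₂ ⟨rfl, h⟩
      refine hI (key b) ?_
      by_cases hab : a = b
      · simpa [hab, hbc.symm] using hI1
      · simpa [hab, hbc.symm] using hI1
    · refine hI (key a) ?_
      by_cases hab : b = a
      · simp only [hab, Ne.symm hac, Ne.symm had, if_true, if_false]
        norm_num
      · simpa [hab, Ne.symm hac, Ne.symm had] using hI1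

/-- Every unit vector is a row of a unitary matrix. -/
lemma exists_unitary_row (u : EuclideanSpace ℂ n) (hu : ‖u‖ = 1) (a : n) :
    ∃ A : Matrix.unitaryGroup n ℂ, ∀ b, (A : Matrix n n ℂ) a b = u b := by
  have ho : Orthonormal ℂ (({a} : Set n).domRestrict fun _ => u) := by
    refine ⟨fun i => hu, fun i j hij => (hij (Subsingleton.elim i j)).elim⟩
  obtain ⟨B, hB⟩ := ho.exists_orthonormalBasis_extension_of_card_eq (by simp)
  refine ⟨⟨Matrix.of fun i j => B i j, ?_⟩, fun b => ?_⟩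
  · rw [Matrix.mem_unitaryGroup_iff]
    ext i j
    have := orthonormal_iff_ite.mp B.orthonormal j i
    simp only [PiLp.inner_apply, RCLike.inner_apply] at this
    simp only [Matrix.mul_apply, Matrix.star_apply, Matrix.of_apply, RCLike.star_def,
      Matrix.one_apply, this, eq_comm]
  · simp [hB a rfl]

/-- Completing `u` to a row of a unitary and using left invariance: every normalized linear
functional of the random vector has the same fourth absolute moment as a coordinate. -/
lemma integral_linear_eq_haarMoment (w : n → ℂ) (u : EuclideanSpace ℂ n) (hu : ‖u‖ = 1) (a : n) :
    ∫ U, ((∑ i, u i * (U : Matrix n n ℂ).mulVec w i) * (∑ i, u i * (U : Matrix n n ℂ).mulVec w i)) *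
      (conj (∑ i, u i * (U : Matrix n n ℂ).mulVec w i) *
        conj (∑ i, u i * (U : Matrix n n ℂ).mulVec w i)) ∂(haarUnitary n) =
      haarMoment w a a a a := by
  obtain ⟨A, hA⟩ := exists_unitary_row u hu a
  rw [haarMoment_mul_left w A]
  have : ∀ x : n → ℂ, (A : Matrix n n ℂ).mulVec x a = ∑ i, u i * x i := fun x => by
    simp only [Matrix.mulVec, dotProduct, hA]
  simp only [this]

lemma haarMoment_diag_eq (w : n → ℂ) (a b : n) :
    haarMoment w a a a a = haarMoment w b b b b := by
  rw [← integral_linear_eq_haarMoment w (EuclideanSpace.single a 1) (by simp) b]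
  simp [haarMoment]

/-- Apply the previous invariance to `u = (e_a + e_b) / √2`. With `α` the diagonal and `β` the mixed
moment, the expansion reads `(2 α + 4 β) / 4 = α`. -/
lemma two_mul_haarMoment_pair (w : n → ℂ) {a b : n} (hab : a ≠ b) (c : n) :
    2 * haarMoment w a b a b = haarMoment w c c c c := by
  have hr : ((Real.sqrt 2 : ℂ))⁻¹ * (Real.sqrt 2 : ℂ)⁻¹ = 1 / 2 := by
    rw [← mul_inv, ← Complex.ofReal_mul, Real.mul_self_sqrt (by norm_num)]
    norm_num
  set r : ℂ := (Real.sqrt 2 : ℂ)⁻¹ with hrdef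
  have hrc : conj r = r := by simp [hrdef]
  let u : EuclideanSpace ℂ n := r • (EuclideanSpace.single a 1 + EuclideanSpace.single b 1)
  have hsum : ∀ x : n → ℂ, ∑ i, u i * x i = r * (x a + x b) := by
    intro x
    simp [u, add_mul, mul_add, Finset.sum_add_distrib]
  have hu : ‖u‖ = 1 := by
    have h : ((‖u‖ ^ 2 : ℝ) : ℂ) = 1 := by
      have h0 := inner_self_eq_norm_sq_to_K (𝕜 := ℂ) u
      rw [Complex.ofReal_pow]
      refine h0.symm.trans ?_
      simp only [PiLp.inner_apply, RCLike.inner_apply]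
      rw [hsum fun i => conj (u i)]
      simp [u, hab, hab.symm, hrc]
      linear_combination 2 * hr
    have h' : ‖u‖ ^ 2 = 1 := by exact_mod_cast h
    nlinarith [norm_nonneg u]
  have key := integral_linear_eq_haarMoment w u hu c
  simp only [hsum] at key
  -- The sixteen terms are grouped so that the first six have paired indices; the other ten
  -- integrate to zero by `haarMoment_eq_zero`.
  have hexp : ∀ x y : ℂ, ((r * (x + y)) * (r * (x + y))) *
      (conj (r * (x + y)) * conj (r * (x + y))) =
      (1 / 4 : ℂ) * (((x * x) * (conj x * conj x) + (y * y) * (conj y * conj y) +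
        (x * y) * (conj x * conj y) + (x * y) * (conj x * conj y) +
        (x * y) * (conj x * conj y) + (x * y) * (conj x * conj y)) +
        ((x * x) * (conj y * conj y) + (y * y) * (conj x * conj x) +
        (x * x) * (conj x * conj y) + (x * x) * (conj x * conj y) +
        (y * y) * (conj x * conj y) + (y * y) * (conj x * conj y) +
        (x * y) * (conj x * conj x) + (x * y) * (conj x * conj x) +
        (x * y) * (conj y * conj y) + (x * y) * (conj y * conj y))) := by
    intro x y
    have : ∀ p q : ℂ, ((r * p) * (r * p)) * ((r * q) * (r * q)) = 1 / 4 * (p * p * (q * q)) := by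
      intro p q
      linear_combination (r * r + 1 / 2) * (p * p * (q * q)) * hr
    rw [map_mul, hrc, this, map_add]
    ring
  simp only [hexp] at key
  have hint : ∀ s t u v : n, Integrable (fun U : Matrix.unitaryGroup n ℂ =>
      ((U : Matrix n n ℂ).mulVec w s * (U : Matrix n n ℂ).mulVec w t) *
        (conj ((U : Matrix n n ℂ).mulVec w u) * conj ((U : Matrix n n ℂ).mulVec w v)))
      (haarUnitary n) := fun s t u v => integrable_haarUnitary_of_continuous (by fun_prop)
  rw [integral_const_mul] at key
  repeat rw [integral_add (by fun_prop) (by fun_prop)] at key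
  change 1 / 4 * ((haarMoment w a a a a + haarMoment w b b b b + haarMoment w a b a b +
    haarMoment w a b a b + haarMoment w a b a b + haarMoment w a b a b) +
    (haarMoment w a a b b + haarMoment w b b a a + haarMoment w a a a b + haarMoment w a a a b +
    haarMoment w b b a b + haarMoment w b b a b + haarMoment w a b a a + haarMoment w a b a a +
    haarMoment w a b b b + haarMoment w a b b b)) = _ at key
  rw [haarMoment_eq_zero w (a := a) (b := a) (c := b) (d := b) (by tauto) (by tauto),
    haarMoment_eq_zero w (a := b) (b := b) (c := a) (d := a) (by tauto) (by tauto),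
    haarMoment_eq_zero w (a := a) (b := a) (c := a) (d := b) (by tauto) (by tauto),
    haarMoment_eq_zero w (a := b) (b := b) (c := a) (d := b) (by tauto) (by tauto),
    haarMoment_eq_zero w (a := a) (b := b) (c := a) (d := a) (by tauto) (by tauto),
    haarMoment_eq_zero w (a := a) (b := b) (c := b) (d := b) (by tauto) (by tauto),
    haarMoment_diag_eq w a c, haarMoment_diag_eq w b c] at key
  linear_combination 2 * key

lemma sum_mulVec_mul_conj (w : EuclideanSpace ℂ n) (hw : ‖w‖ = 1) (U : Matrix.unitaryGroup n ℂ) :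
    ∑ i, (U : Matrix n n ℂ).mulVec w.ofLp i * conj ((U : Matrix n n ℂ).mulVec w.ofLp i) = 1 := by
  have h1 : ∑ i, w i * conj (w i) = 1 := by
    have := inner_self_eq_norm_sq_to_K (𝕜 := ℂ) w
    simpa only [PiLp.inner_apply, RCLike.inner_apply, hw, map_one, one_pow] using this
  have h2 : dotProduct (star ((U : Matrix n n ℂ).mulVec w.ofLp)) ((U : Matrix n n ℂ).mulVec w.ofLp)
      = dotProduct (star w.ofLp) w.ofLp := by
    rw [Matrix.star_mulVec, Matrix.dotProduct_mulVec, Matrix.vecMul_vecMul,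
      ← Matrix.star_eq_conjTranspose, Matrix.UnitaryGroup.star_mul_self, Matrix.vecMul_one]
  simp only [dotProduct, Pi.star_apply, RCLike.star_def] at h2
  simp only [mul_comm] at h1 h2 ⊢
  rw [h2, h1]

/-- Contracting one pair of indices turns fourth moments into second moments. -/
lemma sum_haarMoment (w : EuclideanSpace ℂ n) (hw : ‖w‖ = 1) (a b : n) :
    ∑ c, haarMoment w.ofLp a c b c = ∫ U, (U : Matrix n n ℂ).mulVec w.ofLp a *
      conj ((U : Matrix n n ℂ).mulVec w.ofLp b) ∂(haarUnitary n) := by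
  unfold haarMoment
  rw [← integral_finsetSum _ fun c _ => integrable_haarUnitary_of_continuous (by fun_prop)]
  congr 1
  ext U
  rw [← mul_one (_ * conj _), ← sum_mulVec_mul_conj w hw U, Finset.mul_sum]
  exact Finset.sum_congr rfl fun i _ => by ring

lemma sum_sum_haarMoment (w : EuclideanSpace ℂ n) (hw : ‖w‖ = 1) :
    ∑ a, ∑ c, haarMoment w.ofLp a c a c = 1 := by
  simp only [sum_haarMoment w hw]
  rw [← integral_finsetSum _ fun c _ => integrable_haarUnitary_of_continuous (by fun_prop)]
  simp [sum_mulVec_mul_conj w hw]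

/-- Fourth moments of a Haar-random unit vector. -/
theorem haarMoment_eq (w : EuclideanSpace ℂ n) (hw : ‖w‖ = 1) (a b c d : n) :
    haarMoment w.ofLp a b c d =
      ((if a = c ∧ b = d then 1 else 0) + (if a = d ∧ b = c then 1 else 0)) /
        ((Fintype.card n : ℂ) * (Fintype.card n + 1)) := by
  set α := haarMoment w.ofLp a a a a with hα
  have hpair : ∀ s t : n, haarMoment w.ofLp s t s t = α / 2 * (1 + if s = t then 1 else 0) := by
    intro s t
    by_cases hst : s = t
    · subst hst
      rw [haarMoment_diag_eq w.ofLp s a]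
      simp only [if_true, hα]
      ring
    · rw [hα, ← two_mul_haarMoment_pair w.ofLp hst a]
      simp [hst]
  have hq : (Fintype.card n : ℂ) ≠ 0 := by
    have : Nonempty n := ⟨a⟩
    exact_mod_cast Fintype.card_ne_zero
  have hq1 : (Fintype.card n : ℂ) + 1 ≠ 0 := Nat.cast_add_one_ne_zero _
  -- Normalization fixes the constant: with `q` the cardinality of `n`, it becomes `α / 2 * (q ^ 2 +
  -- q) = 1`.
  have hnorm := sum_sum_haarMoment w hw
  simp only [hpair, ← Finset.mul_sum, Finset.sum_add_distrib, Finset.sum_ite_eq, Finset.sum_const,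
    Finset.card_univ, Finset.mem_univ, if_true, nsmul_eq_mul, mul_one] at hnorm
  have hval : α / 2 = 1 / ((Fintype.card n : ℂ) * (Fintype.card n + 1)) := by
    rw [eq_div_iff (mul_ne_zero hq hq1)]
    linear_combination hnorm
  by_cases h₁ : a = c ∧ b = d
  · obtain ⟨rfl, rfl⟩ := h₁
    rw [hpair, hval]
    by_cases hab : a = b <;> simp [hab, eq_comm, div_eq_inv_mul]
  · by_cases h₂ : a = d ∧ b = c
    · obtain ⟨rfl, rfl⟩ := h₂
      rw [haarMoment_right_comm, hpair, hval]
      have hab : a ≠ b := fun h => h₁ ⟨h, h.symm⟩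
      simp [hab]
    · rw [haarMoment_eq_zero _ h₁ h₂]
      simp [h₁, h₂]

/-- Second moments of a Haar-random unit vector. -/
theorem integral_mulVec_mul_conj (w : EuclideanSpace ℂ n) (hw : ‖w‖ = 1) (a b : n) :
    ∫ U, (U : Matrix n n ℂ).mulVec w.ofLp a *
      conj ((U : Matrix n n ℂ).mulVec w.ofLp b) ∂(haarUnitary n) =
      (if a = b then 1 else 0) / (Fintype.card n : ℂ) := by
  have hq1 : (Fintype.card n : ℂ) + 1 ≠ 0 := Nat.cast_add_one_ne_zero _
  rw [← sum_haarMoment w hw]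
  simp only [haarMoment_eq w hw, ← Finset.sum_div, Finset.sum_add_distrib]
  by_cases hab : a = b
  · subst hab
    have : ∀ c, (a = c ∧ c = a) ↔ a = c := fun c =>
      ⟨fun h => h.1, fun h => ⟨h, h.symm⟩⟩
    simp only [this]
    simp
    field_simp
  · have : ∀ c, ¬ (a = c ∧ c = b) := fun c h => hab (h.1.trans h.2)
    simp [hab, this]

end HaarMoments

end

/-! ### Pairings of four copies and factorization of fourfold sums. -/

noncomputable section

/-- The two ways to pair `a, b` with `c, d`. -/
def Paired {α : Type*} : Bool → α → α → α → α → Prop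
  | true, a, b, c, d => a = c ∧ b = d
  | false, a, b, c, d => a = d ∧ b = c

instance decidablePaired {α : Type*} [DecidableEq α] (s : Bool) (a b c d : α) :
    Decidable (Paired s a b c d) := by
  cases s <;> unfold Paired <;> infer_instance

section FourfoldSums

lemma fourfold_sum_comm {α β : Type*} [Fintype α] [Fintype β] (F : α → α → α → α → β → ℂ) :
    ∑ a, ∑ b, ∑ c, ∑ d, ∑ s, F a b c d s = ∑ s, ∑ a, ∑ b, ∑ c, ∑ d, F a b c d s := by
  simp_rw [Finset.sum_comm (s := (Finset.univ : Finset α)) (t := (Finset.univ : Finset β))]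

lemma fourfold_sum_prod {α β : Type*} [Fintype α] [Fintype β] (F : α → α → α → α → ℂ)
    (G : β → β → β → β → ℂ) :
    ∑ a : α × β, ∑ b : α × β, ∑ c : α × β, ∑ d : α × β,
      F a.1 b.1 c.1 d.1 * G a.2 b.2 c.2 d.2 =
      (∑ a, ∑ b, ∑ c, ∑ d, F a b c d) * ∑ a, ∑ b, ∑ c, ∑ d, G a b c d := by
  have key : ∀ (f : α → ℂ) (g : β → ℂ), ∑ a : α × β, f a.1 * g a.2 = (∑ a, f a) * ∑ b, g b := by
    intro f g
    rw [Fintype.sum_prod_type, Fintype.sum_mul_sum]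
  have h4 : ∀ a b c : α × β, ∑ d : α × β, F a.1 b.1 c.1 d.1 * G a.2 b.2 c.2 d.2 = _ :=
    fun a b c => key (F a.1 b.1 c.1) (G a.2 b.2 c.2)
  have h3 : ∀ a b : α × β, ∑ c : α × β, (∑ d, F a.1 b.1 c.1 d) * ∑ d, G a.2 b.2 c.2 d = _ :=
    fun a b => key (fun c => ∑ d, F a.1 b.1 c d) (fun c => ∑ d, G a.2 b.2 c d)
  have h2 : ∀ a : α × β, ∑ b : α × β, (∑ c, ∑ d, F a.1 b.1 c d) * ∑ c, ∑ d, G a.2 b.2 c d = _ :=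
    fun a => key (fun b => ∑ c, ∑ d, F a.1 b c d) (fun b => ∑ c, ∑ d, G a.2 b c d)
  simp only [h4, h3, h2]
  exact key (fun a => ∑ b, ∑ c, ∑ d, F a b c d) (fun a => ∑ b, ∑ c, ∑ d, G a b c d)

lemma fourfold_sum_pi {ι : Type*} [Fintype ι] [DecidableEq ι] {A : ι → Type*} [∀ i, Fintype (A i)]
    (F : ∀ i, A i → A i → A i → A i → ℂ) :
    ∑ a : ∀ i, A i, ∑ b : ∀ i, A i, ∑ c : ∀ i, A i, ∑ d : ∀ i, A i,
      ∏ i, F i (a i) (b i) (c i) (d i) = ∏ i, ∑ a, ∑ b, ∑ c, ∑ d, F i a b c d := by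
  have h4 : ∀ a b c : ∀ i, A i, ∑ d : ∀ i, A i, ∏ i, F i (a i) (b i) (c i) (d i) = _ :=
    fun a b c => (Fintype.prod_sum fun i => F i (a i) (b i) (c i)).symm
  have h3 : ∀ a b : ∀ i, A i, ∑ c : ∀ i, A i, ∏ i, ∑ d, F i (a i) (b i) (c i) d = _ :=
    fun a b => (Fintype.prod_sum fun i c => ∑ d, F i (a i) (b i) c d).symm
  have h2 : ∀ a : ∀ i, A i, ∑ b : ∀ i, A i, ∏ i, ∑ c, ∑ d, F i (a i) (b i) c d = _ :=
    fun a => (Fintype.prod_sum fun i b => ∑ c, ∑ d, F i (a i) b c d).symm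
  simp only [h4, h3, h2]
  exact (Fintype.prod_sum fun i a => ∑ b, ∑ c, ∑ d, F i a b c d).symm

open ComplexConjugate

lemma sum_conj_mul_self {ι : Type*} [Fintype ι] (f : EuclideanSpace ℂ ι) (hf : ‖f‖ = 1) :
    ∑ i, conj (f i) * f i = 1 := by
  have := inner_self_eq_norm_sq_to_K (𝕜 := ℂ) f
  simpa only [PiLp.inner_apply, RCLike.inner_apply', hf, map_one, one_pow] using this

/-- The weight of four copies of a leg contracted with `f`, whose labels are paired by `s`. -/
def legWeight {ι : Type*} [DecidableEq ι] (f : EuclideanSpace ℂ ι) (s : Bool) (a b c d : ι) : ℂ :=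
  conj (f a) * conj (f b) * (f c * f d) * if Paired s a b c d then 1 else 0

/-- The weight of four copies of an internal edge, whose labels are paired by `σ` at both ends. -/
def edgeWeight {V : Type*} [Fintype V] [DecidableEq V] {m : ℕ} (z : Sym2 V) (σ : V → Bool)
    (a b c d : Fin m) : ℂ :=
  if ∀ v ∈ z, Paired (σ v) a b c d then 1 else 0

/-- Both pairings reduce the sum to `(∑ |f i| ^ 2) ^ 2`. The value does not depend on `s`, so
external and logical legs put no field on the spins. -/
lemma sum_legWeight {ι : Type*} [Fintype ι] [DecidableEq ι] (f : EuclideanSpace ℂ ι)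
    (hf : ‖f‖ = 1) (s : Bool) : ∑ a, ∑ b, ∑ c, ∑ d, legWeight f s a b c d = 1 := by
  unfold legWeight
  have key : ∑ a, ∑ b, conj (f a) * f a * (conj (f b) * f b) = 1 := by
    rw [← Fintype.sum_mul_sum, sum_conj_mul_self f hf, one_mul]
  refine Eq.trans ?_ key
  refine Finset.sum_congr rfl fun a _ => Finset.sum_congr rfl fun b _ => ?_
  cases s
  · simp only [Paired, ite_and, mul_ite, mul_one, mul_zero]
    rw [Finset.sum_comm]
    simp only [Finset.sum_ite_eq, Finset.sum_ite_irrel, Finset.sum_const_zero, Finset.mem_univ,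
      if_true]
    ring
  · simp only [Paired, ite_and, mul_ite, mul_one, mul_zero]
    simp only [Finset.sum_ite_eq, Finset.sum_ite_irrel, Finset.sum_const_zero, Finset.mem_univ,
      if_true]
    ring

/-- Equal spins impose the same pairing twice and leave two free labels; opposite spins force all
four labels to coincide and leave one. -/
lemma sum_edgeWeight {V : Type*} [Fintype V] [DecidableEq V] (z : Sym2 V) (σ : V → Bool) (m : ℕ) :
    ∑ a : Fin m, ∑ b : Fin m, ∑ c : Fin m, ∑ d : Fin m, edgeWeight z σ a b c d =
      if (z.map σ).IsDiag then (m : ℂ) ^ 2 else m := by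
  unfold edgeWeight
  induction z with
  | _ u v =>
    simp only [Sym2.mem_iff, forall_eq_or_imp, forall_eq, Sym2.map_mk, Sym2.mk_isDiag_iff]
    have hne : ∀ a b c d : Fin m, ((a = c ∧ b = d) ∧ a = d ∧ b = c) ↔ a = b ∧ a = c ∧ a = d := by
      intro a b c d
      constructor
      · rintro ⟨⟨rfl, rfl⟩, rfl, _⟩; simp
      · rintro ⟨rfl, rfl, rfl⟩; simp
    have hne' : ∀ a b c d : Fin m, ((a = d ∧ b = c) ∧ a = c ∧ b = d) ↔ a = b ∧ a = c ∧ a = d :=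
      fun a b c d => and_comm.trans (hne a b c d)
    cases hu : σ u <;> cases hv : σ v
    · simp only [Paired, and_self, ite_and]
      simp [sq]
    · simp only [Paired, hne']
      simp [ite_and]
    · simp only [Paired, hne]
      simp [ite_and]
    · simp only [Paired, and_self, ite_and]
      simp [sq]

end FourfoldSums

/-! ### Moments of the network state as partition functions. -/

namespace RTN

set_option linter.unusedSectionVars false

open ComplexConjugate

variable {V E P : Type*} [Fintype V] [DecidableEq V] [Fintype E] [DecidableEq E]
  [Fintype P] [DecidableEq P]

/-- Joint labels of the external edges, the logical legs and the internal edges. -/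
abbrev Labels (N : RTN V E P) : Type _ :=
  (P → Fin N.physDim) × (∀ v, Fin (N.logDim v)) × (∀ e, Fin (N.bondDim e))

/-- Restriction of joint labels to the legs at `v`. -/
def restrict (N : RTN V E P) (v : V) (t : N.Labels) : N.Legs v :=
  (fun p => t.1 p.1, fun e => t.2.2 e.1, t.2.1 v)

/-- The product of the components of all tensors for given labels. -/
def amplitude (N : RTN V E P) (ref : ∀ v, EuclideanSpace ℂ (N.Legs v))
    (U : ∀ v, Matrix.unitaryGroup (N.Legs v) ℂ) (t : N.Labels) : ℂ :=
  ∏ v, ((U v : Matrix (N.Legs v) (N.Legs v) ℂ).mulVec (ref v).ofLp) (N.restrict v t)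

lemma card_legs (N : RTN V E P) (v : V) : Fintype.card (N.Legs v) = N.totalDim v := by
  simp [Legs, totalDim]
  ring

lemma totalDim_pos (N : RTN V E P) (v : V) : 0 < N.totalDim v :=
  Nat.mul_pos (Nat.mul_pos (pow_pos N.physDim_pos _) (N.logDim_pos v))
    (Finset.prod_pos fun e _ => N.bondDim_pos e.1)

instance (N : RTN V E P) : IsProbabilityMeasure N.law := by
  unfold law; infer_instance

lemma restrict_eq_iff (N : RTN V E P) (v : V) (t t' : N.Labels) :
    N.restrict v t = N.restrict v t' ↔ (∀ p, N.site p = v → t.1 p = t'.1 p) ∧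
      t.2.1 v = t'.2.1 v ∧ ∀ e, v ∈ N.ends e → t.2.2 e = t'.2.2 e := by
  simp only [restrict, Prod.mk.injEq, funext_iff, Subtype.forall]
  tauto

lemma forall_restrict_eq_iff (N : RTN V E P) (t t' : N.Labels) :
    (∀ v, N.restrict v t = N.restrict v t') ↔ t = t' := by
  refine ⟨fun h => ?_, fun h => by simp [h]⟩
  simp only [restrict_eq_iff] at h
  refine Prod.ext (funext fun p => (h _).1 p rfl)
    (Prod.ext (funext fun v => (h v).2.1) (funext fun e => ?_))
  exact (h (N.ends e).out.1).2.2 e (Sym2.out_fst_mem _)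

/-- The constraints decouple leg by leg. Only an internal edge sees two spins, which is the source
of the Ising interaction. -/
lemma forall_paired_restrict_iff (N : RTN V E P) (σ : V → Bool) (a b c d : N.Labels) :
    (∀ v, Paired (σ v) (N.restrict v a) (N.restrict v b) (N.restrict v c) (N.restrict v d)) ↔
      (∀ p, Paired (σ (N.site p)) (a.1 p) (b.1 p) (c.1 p) (d.1 p)) ∧
      (∀ v, Paired (σ v) (a.2.1 v) (b.2.1 v) (c.2.1 v) (d.2.1 v)) ∧
      ∀ e, ∀ v ∈ N.ends e, Paired (σ v) (a.2.2 e) (b.2.2 e) (c.2.2 e) (d.2.2 e) := by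
  have key : ∀ v,
      Paired (σ v) (N.restrict v a) (N.restrict v b) (N.restrict v c) (N.restrict v d) ↔
      (∀ p, N.site p = v → Paired (σ v) (a.1 p) (b.1 p) (c.1 p) (d.1 p)) ∧
      Paired (σ v) (a.2.1 v) (b.2.1 v) (c.2.1 v) (d.2.1 v) ∧
      ∀ e, v ∈ N.ends e → Paired (σ v) (a.2.2 e) (b.2.2 e) (c.2.2 e) (d.2.2 e) := by
    intro v
    cases σ v <;> simp only [Paired, restrict_eq_iff] <;> grind
  simp only [key]
  grind

lemma integrable_amplitude_fourfold (N : RTN V E P) (ref : ∀ v, EuclideanSpace ℂ (N.Legs v))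
    (a b c d : N.Labels) :
    Integrable (fun U => N.amplitude ref U a * N.amplitude ref U b *
      (conj (N.amplitude ref U c) * conj (N.amplitude ref U d))) N.law := by
  simp only [amplitude, map_prod, ← Finset.prod_mul_distrib]
  exact Integrable.fintype_prod_dep (f := fun v (U : Matrix.unitaryGroup (N.Legs v) ℂ) =>
    (U : Matrix (N.Legs v) (N.Legs v) ℂ).mulVec (ref v).ofLp (N.restrict v a) *
    (U : Matrix (N.Legs v) (N.Legs v) ℂ).mulVec (ref v).ofLp (N.restrict v b) *
    (conj ((U : Matrix (N.Legs v) (N.Legs v) ℂ).mulVec (ref v).ofLp (N.restrict v c)) *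
    conj ((U : Matrix (N.Legs v) (N.Legs v) ℂ).mulVec (ref v).ofLp (N.restrict v d)))) fun v =>
    integrable_haarUnitary_of_continuous (n := N.Legs v) (by fun_prop)

lemma integrable_amplitude_twofold (N : RTN V E P) (ref : ∀ v, EuclideanSpace ℂ (N.Legs v))
    (a b : N.Labels) :
    Integrable (fun U => N.amplitude ref U a * conj (N.amplitude ref U b)) N.law := by
  simp only [amplitude, map_prod, ← Finset.prod_mul_distrib]
  exact Integrable.fintype_prod_dep (f := fun v (U : Matrix.unitaryGroup (N.Legs v) ℂ) =>
    (U : Matrix (N.Legs v) (N.Legs v) ℂ).mulVec (ref v).ofLp (N.restrict v a) *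
    conj ((U : Matrix (N.Legs v) (N.Legs v) ℂ).mulVec (ref v).ofLp (N.restrict v b))) fun v =>
    integrable_haarUnitary_of_continuous (n := N.Legs v) (by fun_prop)

/-- Independence factorizes the integral over vertices; distributing the product of two-term sums
yields the sum over spin configurations. -/
lemma integral_amplitude_fourfold (N : RTN V E P) (ref : ∀ v, EuclideanSpace ℂ (N.Legs v))
    (href : ∀ v, ‖ref v‖ = 1) (a b c d : N.Labels) :
    ∫ U, N.amplitude ref U a * N.amplitude ref U b *
      (conj (N.amplitude ref U c) * conj (N.amplitude ref U d)) ∂N.law =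
      (∏ v, ((N.totalDim v : ℂ) * (N.totalDim v + 1))⁻¹) *
        ∑ σ : V → Bool, if ∀ v, Paired (σ v) (N.restrict v a) (N.restrict v b) (N.restrict v c)
          (N.restrict v d) then 1 else 0 := by
  simp only [amplitude, map_prod, ← Finset.prod_mul_distrib, law]
  rw [integral_fintype_prod_eq_prod (𝕜 := ℂ) (fun v (U : Matrix.unitaryGroup (N.Legs v) ℂ) =>
    (U : Matrix (N.Legs v) (N.Legs v) ℂ).mulVec (ref v).ofLp (N.restrict v a) *
    (U : Matrix (N.Legs v) (N.Legs v) ℂ).mulVec (ref v).ofLp (N.restrict v b) *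
    (conj ((U : Matrix (N.Legs v) (N.Legs v) ℂ).mulVec (ref v).ofLp (N.restrict v c)) *
    conj ((U : Matrix (N.Legs v) (N.Legs v) ℂ).mulVec (ref v).ofLp (N.restrict v d))))]
  have key : ∀ v, haarMoment (ref v).ofLp (N.restrict v a) (N.restrict v b) (N.restrict v c)
      (N.restrict v d) = ((N.totalDim v : ℂ) * (N.totalDim v + 1))⁻¹ *
      ∑ s : Bool, if Paired s (N.restrict v a) (N.restrict v b) (N.restrict v c)
          (N.restrict v d) then 1 else 0 := by
    intro v
    rw [haarMoment_eq _ (href v), card_legs, div_eq_inv_mul]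
    simp [Paired]
  refine (Finset.prod_congr rfl fun v _ => key v).trans ?_
  rw [Finset.prod_mul_distrib, Fintype.prod_sum]
  simp only [Fintype.prod_boole]

lemma integral_amplitude_twofold (N : RTN V E P) (ref : ∀ v, EuclideanSpace ℂ (N.Legs v))
    (href : ∀ v, ‖ref v‖ = 1) (a b : N.Labels) :
    ∫ U, N.amplitude ref U a * conj (N.amplitude ref U b) ∂N.law =
      (∏ v, (N.totalDim v : ℂ)⁻¹) * if a = b then 1 else 0 := by
  simp only [amplitude, map_prod, ← Finset.prod_mul_distrib, law]
  rw [integral_fintype_prod_eq_prod (𝕜 := ℂ) (fun v (U : Matrix.unitaryGroup (N.Legs v) ℂ) =>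
    (U : Matrix (N.Legs v) (N.Legs v) ℂ).mulVec (ref v).ofLp (N.restrict v a) *
    conj ((U : Matrix (N.Legs v) (N.Legs v) ℂ).mulVec (ref v).ofLp (N.restrict v b)))]
  simp only [integral_mulVec_mul_conj _ (href _), card_legs, div_eq_inv_mul,
    Finset.prod_mul_distrib, Fintype.prod_boole, forall_restrict_eq_iff]

lemma state_apply (N : RTN V E P) (Φ : EuclideanSpace ℂ (∀ v, Fin (N.logDim v)))
    (ref : ∀ v, EuclideanSpace ℂ (N.Legs v)) (U : ∀ v, Matrix.unitaryGroup (N.Legs v) ℂ)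
    (x : P → Fin N.physDim) :
    N.state Φ ref U x = ∑ m : (∀ v, Fin (N.logDim v)) × (∀ e, Fin (N.bondDim e)),
      conj (Φ m.1) * N.amplitude ref U (x, m) := by
  rw [Fintype.sum_prod_type]
  rfl

lemma inner_state_eq (N : RTN V E P) (Φ : EuclideanSpace ℂ (∀ v, Fin (N.logDim v)))
    (φ : EuclideanSpace ℂ (P → Fin N.physDim))
    (ref : ∀ v, EuclideanSpace ℂ (N.Legs v)) (U : ∀ v, Matrix.unitaryGroup (N.Legs v) ℂ) :
    inner ℂ (N.state Φ ref U) φ =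
      conj (∑ t : N.Labels, conj (φ t.1) * conj (Φ t.2.1) * N.amplitude ref U t) := by
  rw [Fintype.sum_prod_type]
  simp only [PiLp.inner_apply, RCLike.inner_apply, state_apply, map_sum, map_mul, Finset.mul_sum,
    Complex.conj_conj, mul_assoc]

lemma ofReal_norm_pow_four (z : ℂ) : ((‖z‖ ^ 4 : ℝ) : ℂ) = z * z * (conj z * conj z) := by
  have := Complex.mul_conj' z
  push_cast
  linear_combination (-((‖z‖ : ℂ) ^ 2) - z * conj z) * this

lemma fourfold_weight_eq_prod (N : RTN V E P) (f : P → EuclideanSpace ℂ (Fin N.physDim))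
    (g : ∀ v, EuclideanSpace ℂ (Fin (N.logDim v))) (σ : V → Bool) (c : N.Labels → ℂ)
    (hc : ∀ t, c t = conj (∏ p, f p (t.1 p)) * conj (∏ v, g v (t.2.1 v)))
    (t₁ t₂ t₃ t₄ : N.Labels) :
    c t₁ * c t₂ * (conj (c t₃) * conj (c t₄)) *
      (if ∀ v, Paired (σ v) (N.restrict v t₁) (N.restrict v t₂) (N.restrict v t₃)
          (N.restrict v t₄) then 1 else 0) =
      (∏ p, legWeight (f p) (σ (N.site p)) (t₁.1 p) (t₂.1 p) (t₃.1 p) (t₄.1 p)) *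
      ((∏ v, legWeight (g v) (σ v) (t₁.2.1 v) (t₂.2.1 v) (t₃.2.1 v) (t₄.2.1 v)) *
      ∏ e, edgeWeight (N.ends e) σ (t₁.2.2 e) (t₂.2.2 e) (t₃.2.2 e) (t₄.2.2 e)) := by
  simp only [legWeight, edgeWeight, Finset.prod_mul_distrib, Fintype.prod_boole]
  rw [if_congr (N.forall_paired_restrict_iff σ t₁ t₂ t₃ t₄) rfl rfl]
  simp only [hc, map_mul, Complex.conj_conj, map_prod, ite_and]
  split_ifs <;> ring

lemma sum_fourfold_weights (N : RTN V E P) (f : P → EuclideanSpace ℂ (Fin N.physDim))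
    (hf : ∀ p, ‖f p‖ = 1) (g : ∀ v, EuclideanSpace ℂ (Fin (N.logDim v)))
    (hg : ∀ v, ‖g v‖ = 1) (σ : V → Bool) (c : N.Labels → ℂ)
    (hc : ∀ t, c t = conj (∏ p, f p (t.1 p)) * conj (∏ v, g v (t.2.1 v))) :
    ∑ t₁, ∑ t₂, ∑ t₃, ∑ t₄, c t₁ * c t₂ * (conj (c t₃) * conj (c t₄)) *
      (if ∀ v, Paired (σ v) (N.restrict v t₁) (N.restrict v t₂) (N.restrict v t₃)
          (N.restrict v t₄) then 1 else 0) =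
      ∏ e, if ((N.ends e).map σ).IsDiag then (N.bondDim e : ℂ) ^ 2 else N.bondDim e := by
  simp only [N.fourfold_weight_eq_prod f g σ c hc]
  rw [fourfold_sum_prod
    (fun a b c d : P → Fin N.physDim =>
      ∏ p, legWeight (f p) (σ (N.site p)) (a p) (b p) (c p) (d p))
    (fun a b c d : (∀ v, Fin (N.logDim v)) × (∀ e, Fin (N.bondDim e)) =>
      (∏ v, legWeight (g v) (σ v) (a.1 v) (b.1 v) (c.1 v) (d.1 v)) *
        ∏ e, edgeWeight (N.ends e) σ (a.2 e) (b.2 e) (c.2 e) (d.2 e)),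
    fourfold_sum_prod
    (fun a b c d : ∀ v, Fin (N.logDim v) => ∏ v, legWeight (g v) (σ v) (a v) (b v) (c v) (d v))
    (fun a b c d : ∀ e, Fin (N.bondDim e) =>
      ∏ e, edgeWeight (N.ends e) σ (a e) (b e) (c e) (d e)),
    fourfold_sum_pi (fun p => legWeight (f p) (σ (N.site p))),
    fourfold_sum_pi (fun v => legWeight (g v) (σ v)),
    fourfold_sum_pi (fun e => edgeWeight (m := N.bondDim e) (N.ends e) σ)]
  simp only [sum_legWeight _ (hf _), sum_legWeight _ (hg _), sum_edgeWeight,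
    Finset.prod_const_one, one_mul]

/-- The fourth moment of the overlap is an Ising partition function on the graph. -/
theorem integral_inner_state_pow_four (N : RTN V E P)
    (Φ : EuclideanSpace ℂ (∀ v, Fin (N.logDim v))) (φ : EuclideanSpace ℂ (P → Fin N.physDim))
    (ref : ∀ v, EuclideanSpace ℂ (N.Legs v)) (hΦ : IsUnentangled Φ) (hφ : IsUnentangled φ)
    (href : ∀ v, ‖ref v‖ = 1) :
    ∫ U, ‖inner ℂ (N.state Φ ref U) φ‖ ^ 4 ∂N.law =
      (∏ v, ((N.totalDim v : ℝ) * (N.totalDim v + 1))⁻¹) * ∑ σ : V → Bool,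
        ∏ e, if ((N.ends e).map σ).IsDiag then (N.bondDim e : ℝ) ^ 2 else N.bondDim e := by
  obtain ⟨f, hf, hφ⟩ := hφ
  obtain ⟨g, hg, hΦ⟩ := hΦ
  apply Complex.ofReal_injective
  rw [← integral_complex_ofReal]
  set c : N.Labels → ℂ := fun t => conj (φ t.1) * conj (Φ t.2.1) with hc
  have hexp : ∀ U, ((‖inner ℂ (N.state Φ ref U) φ‖ ^ 4 : ℝ) : ℂ) =
      ∑ t₁, ∑ t₂, ∑ t₃, ∑ t₄, c t₁ * c t₂ * (conj (c t₃) * conj (c t₄)) *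
        (N.amplitude ref U t₁ * N.amplitude ref U t₂ *
          (conj (N.amplitude ref U t₃) * conj (N.amplitude ref U t₄))) := by
    intro U
    rw [inner_state_eq, RCLike.norm_conj, ofReal_norm_pow_four, map_sum, Fintype.sum_mul_sum,
      Fintype.sum_mul_sum, Finset.sum_mul]
    refine Finset.sum_congr rfl fun t₁ _ => ?_
    rw [Finset.sum_mul]
    refine Finset.sum_congr rfl fun t₂ _ => ?_
    rw [Finset.mul_sum]
    refine Finset.sum_congr rfl fun t₃ _ => ?_
    rw [Finset.mul_sum]
    refine Finset.sum_congr rfl fun t₄ _ => ?_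
    simp only [hc, map_mul]
    ring
  simp only [hexp]
  have hint : ∀ t₁ t₂ t₃ t₄ : N.Labels, Integrable (fun U =>
      c t₁ * c t₂ * (conj (c t₃) * conj (c t₄)) *
        (N.amplitude ref U t₁ * N.amplitude ref U t₂ *
          (conj (N.amplitude ref U t₃) * conj (N.amplitude ref U t₄)))) N.law :=
    fun t₁ t₂ t₃ t₄ => (N.integrable_amplitude_fourfold ref t₁ t₂ t₃ t₄).const_mul _
  have hsum : ∫ U, ∑ t₁, ∑ t₂, ∑ t₃, ∑ t₄, c t₁ * c t₂ * (conj (c t₃) * conj (c t₄)) *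
        (N.amplitude ref U t₁ * N.amplitude ref U t₂ *
          (conj (N.amplitude ref U t₃) * conj (N.amplitude ref U t₄))) ∂N.law =
      ∑ t₁, ∑ t₂, ∑ t₃, ∑ t₄, ∫ U, c t₁ * c t₂ * (conj (c t₃) * conj (c t₄)) *
        (N.amplitude ref U t₁ * N.amplitude ref U t₂ *
          (conj (N.amplitude ref U t₃) * conj (N.amplitude ref U t₄))) ∂N.law := by
    rw [integral_finsetSum _ fun t₁ _ => integrable_finsetSum _ fun t₂ _ =>
      integrable_finsetSum _ fun t₃ _ => integrable_finsetSum _ fun t₄ _ => hint t₁ t₂ t₃ t₄]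
    refine Finset.sum_congr rfl fun t₁ _ => ?_
    rw [integral_finsetSum _ fun t₂ _ =>
      integrable_finsetSum _ fun t₃ _ => integrable_finsetSum _ fun t₄ _ => hint t₁ t₂ t₃ t₄]
    refine Finset.sum_congr rfl fun t₂ _ => ?_
    rw [integral_finsetSum _ fun t₃ _ => integrable_finsetSum _ fun t₄ _ => hint t₁ t₂ t₃ t₄]
    refine Finset.sum_congr rfl fun t₃ _ => ?_
    rw [integral_finsetSum _ fun t₄ _ => hint t₁ t₂ t₃ t₄]
  rw [hsum]
  simp only [integral_const_mul, integral_amplitude_fourfold N ref href]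
  -- The sum over `σ` is moved outermost, because the label sums factorize over legs only for a
  -- fixed spin configuration.
  simp only [mul_left_comm _ (∏ v, ((N.totalDim v : ℂ) * (N.totalDim v + 1))⁻¹) _,
    ← Finset.mul_sum]
  simp only [Finset.mul_sum]
  rw [fourfold_sum_comm]
  simp only [← Finset.mul_sum]
  have hw := fun σ => N.sum_fourfold_weights f hf g hg σ c (fun t => by simp only [hc, hφ, hΦ])
  simp only [hw]
  push_cast
  congr 1
  refine Finset.sum_congr rfl fun σ _ => Finset.prod_congr rfl fun e _ => ?_
  split_ifs <;> simp

lemma sum_conj_mul_self_of_isUnentangled {ι : Type*} [Fintype ι] [DecidableEq ι] {d : ι → ℕ}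
    {Φ : EuclideanSpace ℂ (∀ i, Fin (d i))} (hΦ : IsUnentangled Φ) :
    ∑ l, conj (Φ l) * Φ l = 1 := by
  obtain ⟨g, hg, hΦ⟩ := hΦ
  simp only [hΦ, map_prod, ← Finset.prod_mul_distrib]
  rw [← Fintype.prod_sum fun i y => conj (g i y) * g i y]
  simp [sum_conj_mul_self _ (hg _)]

/-- Second moments force both copies to carry the same labels. The free external and internal labels
are then counted, while the logical ones sum to `‖Φ‖ ^ 2 = 1`. -/
theorem integral_norm_state_sq (N : RTN V E P)
    (Φ : EuclideanSpace ℂ (∀ v, Fin (N.logDim v)))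
    (ref : ∀ v, EuclideanSpace ℂ (N.Legs v)) (hΦ : IsUnentangled Φ) (href : ∀ v, ‖ref v‖ = 1) :
    ∫ U, ‖N.state Φ ref U‖ ^ 2 ∂N.law =
      (∏ v, (N.totalDim v : ℝ)⁻¹) * ((N.physDim : ℝ) ^ Fintype.card P * ∏ e, (N.bondDim e : ℝ)) := by
  apply Complex.ofReal_injective
  rw [← integral_complex_ofReal]
  have hexp : ∀ U, ((‖N.state Φ ref U‖ ^ 2 : ℝ) : ℂ) =
      ∑ x, ∑ m : (∀ v, Fin (N.logDim v)) × (∀ e, Fin (N.bondDim e)),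
        ∑ m' : (∀ v, Fin (N.logDim v)) × (∀ e, Fin (N.bondDim e)),
        conj (Φ m.1) * Φ m'.1 *
          (N.amplitude ref U (x, m) * conj (N.amplitude ref U (x, m'))) := by
    intro U
    have h := inner_self_eq_norm_sq_to_K (𝕜 := ℂ) (N.state Φ ref U)
    rw [Complex.ofReal_pow]
    refine h.symm.trans ?_
    simp only [PiLp.inner_apply, RCLike.inner_apply, state_apply, map_sum, map_mul,
      Complex.conj_conj, Fintype.sum_mul_sum]
    refine Finset.sum_congr rfl fun x _ => Finset.sum_congr rfl fun m _ =>
      Finset.sum_congr rfl fun m' _ => ?_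
    ring
  simp only [hexp]
  have hint : ∀ x (m m' : (∀ v, Fin (N.logDim v)) × (∀ e, Fin (N.bondDim e))),
      Integrable (fun U => conj (Φ m.1) * Φ m'.1 *
          (N.amplitude ref U (x, m) * conj (N.amplitude ref U (x, m')))) N.law :=
    fun x m m' => (N.integrable_amplitude_twofold ref _ _).const_mul _
  rw [integral_finsetSum _ fun x _ => integrable_finsetSum _ fun m _ =>
      integrable_finsetSum _ fun m' _ => hint x m m']
  have hx : ∀ x, ∫ U, ∑ m : (∀ v, Fin (N.logDim v)) × (∀ e, Fin (N.bondDim e)),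
        ∑ m' : (∀ v, Fin (N.logDim v)) × (∀ e, Fin (N.bondDim e)),
        conj (Φ m.1) * Φ m'.1 *
          (N.amplitude ref U (x, m) * conj (N.amplitude ref U (x, m'))) ∂N.law =
      (∏ v, (N.totalDim v : ℂ)⁻¹) * ∏ e, (N.bondDim e : ℂ) := by
    intro x
    rw [integral_finsetSum _ fun m _ => integrable_finsetSum _ fun m' _ => hint x m m']
    have hm : ∀ m, ∫ U, ∑ m' : (∀ v, Fin (N.logDim v)) × (∀ e, Fin (N.bondDim e)),
        conj (Φ m.1) * Φ m'.1 *
          (N.amplitude ref U (x, m) * conj (N.amplitude ref U (x, m'))) ∂N.law =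
        (∏ v, (N.totalDim v : ℂ)⁻¹) * (conj (Φ m.1) * Φ m.1) := by
      intro m
      rw [integral_finsetSum _ fun m' _ => hint x m m']
      simp only [integral_const_mul, integral_amplitude_twofold N ref href, Prod.mk.injEq, true_and,
        mul_ite, mul_one, mul_zero]
      rw [Finset.sum_ite_eq]
      simp [mul_comm]
    simp only [hm, ← Finset.mul_sum]
    congr 1
    rw [Fintype.sum_prod_type]
    simp only [Finset.sum_const, Finset.card_univ, Fintype.card_pi, Fintype.card_fin, nsmul_eq_mul,
      ← Finset.mul_sum, sum_conj_mul_self_of_isUnentangled hΦ]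
    simp
  simp only [hx]
  simp
  ring

/-- The Ising partition function in which an internal edge cut by `σ` has weight `1 / b_e`. -/
def isingSum (N : RTN V E P) : ℝ :=
  ∑ σ : V → Bool, ∏ e, if ((N.ends e).map σ).IsDiag then 1 else (N.bondDim e : ℝ)⁻¹

lemma isingSum_pos (N : RTN V E P) : 0 < N.isingSum := by
  refine Finset.sum_pos (fun σ _ => Finset.prod_pos fun e _ => ?_) Finset.univ_nonempty
  have : (0 : ℝ) < N.bondDim e := by exact_mod_cast N.bondDim_pos e
  split_ifs <;> positivity

/-- The result involves neither the unentangled vectors nor `ref`, so the vectors chosen for two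
networks need not be related in any comparison. -/
theorem effDim_eq (N : RTN V E P)
    (Φ : EuclideanSpace ℂ (∀ v, Fin (N.logDim v))) (φ : EuclideanSpace ℂ (P → Fin N.physDim))
    (ref : ∀ v, EuclideanSpace ℂ (N.Legs v)) (hΦ : IsUnentangled Φ) (hφ : IsUnentangled φ)
    (href : ∀ v, ‖ref v‖ = 1) :
    N.effDim Φ φ ref = (N.physDim : ℝ) ^ Fintype.card P /
      ((∏ v, (N.totalDim v : ℝ) / (N.totalDim v + 1)) * N.isingSum) := by
  have ha : (N.physDim : ℝ) ≠ 0 := by exact_mod_cast N.physDim_pos.ne'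
  have hb : ∀ e, (N.bondDim e : ℝ) ≠ 0 := fun e => by exact_mod_cast (N.bondDim_pos e).ne'
  have hq : ∀ v, (N.totalDim v : ℝ) ≠ 0 := fun v => by exact_mod_cast (N.totalDim_pos v).ne'
  have hq1 : ∀ v, (N.totalDim v : ℝ) + 1 ≠ 0 := fun v => by positivity
  -- Taking `b_e ^ 2` out of every edge turns the weights `b_e ^ 2` and `b_e` into `1` and `1 /
  -- b_e`.
  have hZ : (∑ σ : V → Bool,
      ∏ e, if ((N.ends e).map σ).IsDiag then (N.bondDim e : ℝ) ^ 2 else N.bondDim e) =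
      (∏ e, (N.bondDim e : ℝ)) ^ 2 * N.isingSum := by
    rw [isingSum, Finset.mul_sum]
    refine Finset.sum_congr rfl fun σ _ => ?_
    rw [← Finset.prod_pow, ← Finset.prod_mul_distrib]
    refine Finset.prod_congr rfl fun e _ => ?_
    have := hb e
    split_ifs
    · ring
    · field_simp
  rw [effDim, N.integral_inner_state_pow_four Φ φ ref hΦ hφ href,
    N.integral_norm_state_sq Φ ref hΦ href, hZ]
  have hB : ∏ e, (N.bondDim e : ℝ) ≠ 0 := Finset.prod_ne_zero_iff.mpr fun e _ => hb e
  have hQ : ∏ v, (N.totalDim v : ℝ) ≠ 0 := Finset.prod_ne_zero_iff.mpr fun v _ => hq v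
  have hQ1 : ∏ v, ((N.totalDim v : ℝ) + 1) ≠ 0 := Finset.prod_ne_zero_iff.mpr fun v _ => hq1 v
  have hI := N.isingSum_pos.ne'
  simp only [Finset.prod_inv_distrib, Finset.prod_mul_distrib, Finset.prod_div_distrib]
  field_simp

end RTN

end

/-! ### Tensor dimensions under fusion. -/

noncomputable section

namespace RTN

section Fusion

set_option linter.unusedSectionVars false

variable {V E P : Type*} [Fintype V] [DecidableEq V] [Fintype E] [DecidableEq E]
  [Fintype P] [DecidableEq P]

lemma fuseMap_eq_mk_iff {V : Type*} [DecidableEq V] {j k : V} (hjk : j ≠ k) (u v : V)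
    (hv : v ≠ k) : fuseMap hjk u = ⟨v, hv⟩ ↔ u = v ∨ (u = k ∧ v = j) := by
  unfold fuseMap
  split_ifs with h
  · subst h
    simp [hv.symm, eq_comm (a := v)]
  · simp [h]

lemma mk_mem_map_fuseMap_iff {V : Type*} [DecidableEq V] {j k : V} (hjk : j ≠ k) (z : Sym2 V)
    (v : V) (hv : v ≠ k) :
    (⟨v, hv⟩ : {v : V // v ≠ k}) ∈ z.map (fuseMap hjk) ↔ v ∈ z ∨ (k ∈ z ∧ v = j) := by
  simp only [Sym2.mem_map, fuseMap_eq_mk_iff]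
  constructor
  · rintro ⟨u, hu, rfl | ⟨rfl, rfl⟩⟩
    · exact Or.inl hu
    · exact Or.inr ⟨hu, rfl⟩
  · rintro (h | ⟨h, rfl⟩)
    · exact ⟨v, h, Or.inl rfl⟩
    · exact ⟨k, h, Or.inr ⟨rfl, rfl⟩⟩

lemma totalDim_eq_prod_ite {V E P : Type*} [DecidableEq V] [Fintype E] [Fintype P]
    (N : RTN V E P) (v : V) :
    N.totalDim v = N.physDim ^ Fintype.card {p : P // N.site p = v} * N.logDim v *
      ∏ e, if v ∈ N.ends e then N.bondDim e else 1 := by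
  rw [totalDim, ← Finset.prod_filter]
  congr 1
  exact (Finset.prod_subtype (Finset.univ.filter fun e => v ∈ N.ends e) (by simp) N.bondDim).symm

/-- The dimension of all legs at `v` other than the internal edges that join `j` and `k`. -/
def outerDim (N : RTN V E P) (j k v : V) : ℕ :=
  N.physDim ^ Fintype.card {p : P // N.site p = v} * N.logDim v *
    ∏ e : {e : E // N.ends e ≠ s(j, k)}, if v ∈ N.ends e.1 then N.bondDim e.1 else 1

lemma totalDim_eq_outerDim_mul (N : RTN V E P) (j k v : V) (hv : v ∈ s(j, k)) :
    N.totalDim v = N.outerDim j k v * N.bondDimBetween j k := by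
  rw [totalDim_eq_prod_ite, outerDim, bondDimBetween, mul_assoc (_ * _)]
  congr 1
  rw [← Fintype.prod_subtype_mul_prod_subtype (fun e => N.ends e = s(j, k)), mul_comm]
  congr 1
  exact Finset.prod_congr rfl fun e _ => by rw [e.2, if_pos hv]

lemma fuse_totalDim_self (N : RTN V E P) {j k : V} (hjk : j ≠ k) :
    (N.fuse hjk).totalDim ⟨j, hjk⟩ = N.outerDim j k j * N.outerDim j k k := by
  have hcard : Fintype.card {p : P // (N.fuse hjk).site p = ⟨j, hjk⟩} =
      Fintype.card {p : P // N.site p = j} + Fintype.card {p : P // N.site p = k} := by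
    rw [← Fintype.card_subtype_or_disjoint]
    · refine Fintype.card_congr (Equiv.subtypeEquivRight fun p => ?_)
      simp [fuse, fuseMap_eq_mk_iff]
    · rw [Pi.disjoint_iff]
      intro p
      simp only [Prop.disjoint_iff]
      rintro ⟨h₁, h₂⟩
      exact hjk (h₁.symm.trans h₂)
  have hprod : (∏ e, if (⟨j, hjk⟩ : {v : V // v ≠ k}) ∈ (N.fuse hjk).ends e then
      (N.fuse hjk).bondDim e else 1) =
      (∏ e : {e : E // N.ends e ≠ s(j, k)}, if j ∈ N.ends e.1 then N.bondDim e.1 else 1) *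
      ∏ e : {e : E // N.ends e ≠ s(j, k)}, if k ∈ N.ends e.1 then N.bondDim e.1 else 1 := by
    rw [← Finset.prod_mul_distrib]
    refine Finset.prod_congr rfl fun e _ => ?_
    have hmem : (⟨j, hjk⟩ : {v : V // v ≠ k}) ∈ (N.fuse hjk).ends e ↔
        j ∈ N.ends e.1 ∨ k ∈ N.ends e.1 :=
      (mk_mem_map_fuseMap_iff hjk (N.ends e.1) j hjk).trans (by simp)
    -- A surviving edge meets at most one of `j` and `k`, so no bond dimension is counted twice in
    -- the product.
    have hnot : ¬ (j ∈ N.ends e.1 ∧ k ∈ N.ends e.1) := fun h =>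
      e.2 ((Sym2.mem_and_mem_iff hjk).mp h)
    have hb : (N.fuse hjk).bondDim e = N.bondDim e.1 := rfl
    rw [if_congr hmem rfl rfl, hb]
    by_cases h₁ : j ∈ N.ends e.1 <;> by_cases h₂ : k ∈ N.ends e.1 <;> simp_all
  have hlog : (N.fuse hjk).logDim ⟨j, hjk⟩ = N.logDim j * N.logDim k := by simp [fuse]
  have hphys : (N.fuse hjk).physDim = N.physDim := rfl
  rw [totalDim_eq_prod_ite, hcard, hprod, hlog, hphys, outerDim, outerDim, pow_add]
  ring

lemma fuse_totalDim_of_ne (N : RTN V E P) {j k : V} (hjk : j ≠ k) (v : V) (hvk : v ≠ k)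
    (hvj : v ≠ j) : (N.fuse hjk).totalDim ⟨v, hvk⟩ = N.totalDim v := by
  have hcard : Fintype.card {p : P // (N.fuse hjk).site p = ⟨v, hvk⟩} =
      Fintype.card {p : P // N.site p = v} :=
    Fintype.card_congr (Equiv.subtypeEquivRight fun p => by simp [fuse, fuseMap_eq_mk_iff, hvj])
  have hlog : (N.fuse hjk).logDim ⟨v, hvk⟩ = N.logDim v := by simp [fuse, hvj]
  have hphys : (N.fuse hjk).physDim = N.physDim := rfl
  rw [totalDim_eq_prod_ite, totalDim_eq_prod_ite, hcard, hlog, hphys]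
  congr 1
  rw [← Fintype.prod_subtype_mul_prod_subtype (fun e => N.ends e = s(j, k))]
  have h1 : (∏ e : {e // N.ends e = s(j, k)}, if v ∈ N.ends e.1 then N.bondDim e.1 else 1) = 1 :=
    Finset.prod_eq_one fun e _ => by
      rw [e.2, if_neg (by simp [hvj, hvk])]
  rw [h1, one_mul]
  refine Finset.prod_congr rfl fun e _ => ?_
  have hb : (N.fuse hjk).bondDim e = N.bondDim e.1 := rfl
  rw [hb]
  exact if_congr ((mk_mem_map_fuseMap_iff hjk (N.ends e.1) v hvk).trans (by simp [hvj])) rfl rfl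

lemma outerDim_pos (N : RTN V E P) (j k v : V) : 0 < N.outerDim j k v :=
  Nat.mul_pos (Nat.mul_pos (pow_pos N.physDim_pos _) (N.logDim_pos v))
    (Finset.prod_pos fun e _ => by split_ifs <;> simp [N.bondDim_pos])

/-! ### Comparison of aligned and opposed spins. -/

/-- The Ising weight of the edge `e`. -/
def cutWeight (N : RTN V E P) (σ : V → Bool) (e : E) : ℝ :=
  if ((N.ends e).map σ).IsDiag then 1 else (N.bondDim e : ℝ)⁻¹

/-- The Ising weight of all edges other than those joining `j` and `k`. -/
def outerWeight (N : RTN V E P) (j k : V) (σ : V → Bool) : ℝ :=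
  ∏ e : {e : E // N.ends e ≠ s(j, k)}, N.cutWeight σ e.1

/-- The Ising weight of all edges at `v` other than those joining `j` and `k`. -/
def starWeight (N : RTN V E P) (j k v : V) (σ : V → Bool) : ℝ :=
  ∏ e : {e : E // N.ends e ≠ s(j, k)}, if v ∈ N.ends e.1 then N.cutWeight σ e.1 else 1

lemma one_le_bondDim (N : RTN V E P) (e : E) : (1 : ℝ) ≤ N.bondDim e := by
  exact_mod_cast N.bondDim_pos e

lemma cutWeight_pos (N : RTN V E P) (σ : V → Bool) (e : E) : 0 < N.cutWeight σ e := by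
  have := N.one_le_bondDim e
  unfold cutWeight
  split_ifs <;> positivity

/-- Both weights lie between `1 / b_e` and `1`. -/
lemma cutWeight_le (N : RTN V E P) (σ τ : V → Bool) (e : E) :
    N.cutWeight σ e ≤ N.bondDim e * N.cutWeight τ e := by
  have h := N.one_le_bondDim e
  have h0 : (N.bondDim e : ℝ) ≠ 0 := by positivity
  have hi : (N.bondDim e : ℝ)⁻¹ ≤ 1 := inv_le_one_of_one_le₀ h
  unfold cutWeight
  split_ifs
  · simpa using h
  · simp [h0]
  · linarith
  · simpa [h0] using hi

lemma cutWeight_congr (N : RTN V E P) {σ τ : V → Bool} {e : E} (h : ∀ v ∈ N.ends e, σ v = τ v) :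
    N.cutWeight σ e = N.cutWeight τ e := by
  unfold cutWeight
  rw [Sym2.map_congr h]

lemma outerWeight_pos (N : RTN V E P) (j k : V) (σ : V → Bool) : 0 < N.outerWeight j k σ :=
  Finset.prod_pos fun e _ => N.cutWeight_pos σ e.1

lemma starWeight_nonneg (N : RTN V E P) (j k v : V) (σ : V → Bool) : 0 ≤ N.starWeight j k v σ :=
  Finset.prod_nonneg fun e _ => by split_ifs <;> simp [(N.cutWeight_pos σ e.1).le]

lemma starWeight_le (N : RTN V E P) (j k v : V) (σ τ : V → Bool) :
    N.starWeight j k v σ ≤ N.outerDim j k v * N.starWeight j k v τ := by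
  have h1 : N.starWeight j k v σ ≤
      ((∏ e : {e : E // N.ends e ≠ s(j, k)}, if v ∈ N.ends e.1 then N.bondDim e.1 else 1 : ℕ) : ℝ) *
        N.starWeight j k v τ := by
    unfold starWeight
    rw [Nat.cast_prod, ← Finset.prod_mul_distrib]
    refine Finset.prod_le_prod (fun e _ => ?_) fun e _ => ?_
    · split_ifs <;> simp [(N.cutWeight_pos σ e.1).le]
    · split_ifs
      · exact N.cutWeight_le σ τ e.1
      · simp
  -- The physical and logical legs at `v` only enlarge the bound, their dimensions being at least 1.
  refine h1.trans (mul_le_mul_of_nonneg_right ?_ (N.starWeight_nonneg j k v τ))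
  rw [outerDim]
  exact_mod_cast Nat.le_mul_of_pos_left _
    (Nat.mul_pos (pow_pos N.physDim_pos _) (N.logDim_pos v))

/-- Reversal of the spin at `v`. -/
def flipSpin (v : V) : Equiv.Perm (V → Bool) :=
  Function.Involutive.toPerm (fun σ => Function.update σ v (!σ v)) fun σ => by
    ext u
    by_cases h : u = v
    · subst h; simp
    · simp [h]

lemma flipSpin_self (v : V) (σ : V → Bool) : flipSpin v σ v = !σ v :=
  Function.update_self v _ σ

lemma flipSpin_of_ne {u v : V} (h : u ≠ v) (σ : V → Bool) : flipSpin v σ u = σ u :=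
  Function.update_of_ne h _ σ

lemma outerWeight_factor (N : RTN V E P) {j k : V} (hjk : j ≠ k) (σ : V → Bool) :
    ∃ R : ℝ, 0 ≤ R ∧ ∀ τ : V → Bool, (∀ v, v ≠ j → v ≠ k → τ v = σ v) →
      N.outerWeight j k τ = N.starWeight j k j τ * N.starWeight j k k τ * R := by
  -- `R` collects the edges that touch neither `j` nor `k`; their weights are unaffected by the two
  -- spins.
  refine ⟨∏ e : {e : E // N.ends e ≠ s(j, k)},
    if j ∈ N.ends e.1 ∨ k ∈ N.ends e.1 then 1 else N.cutWeight σ e.1, ?_, fun τ hτ => ?_⟩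
  · exact Finset.prod_nonneg fun e _ => by split_ifs <;> simp [(N.cutWeight_pos σ e.1).le]
  · unfold outerWeight starWeight
    rw [← Finset.prod_mul_distrib, ← Finset.prod_mul_distrib]
    refine Finset.prod_congr rfl fun e _ => ?_
    by_cases h₁ : j ∈ N.ends e.1 <;> by_cases h₂ : k ∈ N.ends e.1
    · exact absurd ((Sym2.mem_and_mem_iff hjk).mp ⟨h₁, h₂⟩) e.2
    · simp [h₁, h₂]
    · simp [h₁, h₂]
    · have : N.cutWeight τ e.1 = N.cutWeight σ e.1 := N.cutWeight_congr fun v hv =>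
        hτ v (fun h => h₁ (h ▸ hv)) (fun h => h₂ (h ▸ hv))
      simp [h₁, h₂, this]

lemma starWeight_congr (N : RTN V E P) {j k v : V} {σ τ : V → Bool}
    (h : ∀ e, N.ends e ≠ s(j, k) → v ∈ N.ends e → ∀ u ∈ N.ends e, σ u = τ u) :
    N.starWeight j k v σ = N.starWeight j k v τ := by
  refine Finset.prod_congr rfl fun e _ => ?_
  split_ifs with hv
  · exact N.cutWeight_congr (h e.1 e.2 hv)
  · rfl

/-- With all other spins fixed, the outer weight is `A C R`, where `A` depends only on the spin at
`j` and `C` only on that at `k`. Primes denoting flipped spins, the difference of the two sides is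
`R` times `(x A' - A) (y C - C') + (x A - A') (y C' - C)`, whose four factors are nonnegative by
`starWeight_le`. -/
lemma outerWeight_flip_le (N : RTN V E P) {j k : V} (hjk : j ≠ k) (σ : V → Bool) :
    ((N.outerDim j k j : ℝ) + N.outerDim j k k) *
        (N.outerWeight j k σ + N.outerWeight j k (flipSpin j (flipSpin k σ))) ≤
      ((N.outerDim j k j : ℝ) * N.outerDim j k k + 1) *
        (N.outerWeight j k (flipSpin j σ) + N.outerWeight j k (flipSpin k σ)) := by
  obtain ⟨R, hR, hfac⟩ := N.outerWeight_factor hjk σ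
  have hmem : ∀ e, N.ends e ≠ s(j, k) → j ∈ N.ends e → k ∈ N.ends e → False := fun e he h₁ h₂ =>
    he ((Sym2.mem_and_mem_iff hjk).mp ⟨h₁, h₂⟩)
  have hj : ∀ τ, N.starWeight j k j (flipSpin k τ) = N.starWeight j k j τ := fun τ =>
    N.starWeight_congr fun e he hv u hu => flipSpin_of_ne (by rintro rfl; exact hmem e he hv hu) τ
  have hk : ∀ τ, N.starWeight j k k (flipSpin j τ) = N.starWeight j k k τ := fun τ =>
    N.starWeight_congr fun e he hv u hu => flipSpin_of_ne (by rintro rfl; exact hmem e he hu hv) τ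
  have hcomm : N.starWeight j k j (flipSpin j (flipSpin k σ)) =
      N.starWeight j k j (flipSpin j σ) := by
    refine N.starWeight_congr fun e he hv u hu => ?_
    by_cases huj : u = j
    · subst huj
      rw [flipSpin_self, flipSpin_self, flipSpin_of_ne hjk]
    · rw [flipSpin_of_ne huj, flipSpin_of_ne huj,
        flipSpin_of_ne (by rintro rfl; exact hmem e he hv hu)]
  rw [hfac σ (fun _ _ _ => rfl),
    hfac (flipSpin j (flipSpin k σ)) (fun v h₁ h₂ => by
      rw [flipSpin_of_ne h₁, flipSpin_of_ne h₂]),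
    hfac (flipSpin j σ) (fun v h₁ h₂ => flipSpin_of_ne h₁ σ),
    hfac (flipSpin k σ) (fun v h₁ h₂ => flipSpin_of_ne h₂ σ), hj, hk, hk, hcomm]
  have h1 := sub_nonneg.mpr (N.starWeight_le j k j σ (flipSpin j σ))
  have h2 := sub_nonneg.mpr (N.starWeight_le j k j (flipSpin j σ) σ)
  have h3 := sub_nonneg.mpr (N.starWeight_le j k k σ (flipSpin k σ))
  have h4 := sub_nonneg.mpr (N.starWeight_le j k k (flipSpin k σ) σ)
  have h := mul_nonneg (add_nonneg (mul_nonneg h1 h4) (mul_nonneg h2 h3)) hR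
  linarith

/-- The outer weights of all configurations in which `j` and `k` have equal spins. -/
def alignedSum (N : RTN V E P) (j k : V) : ℝ :=
  ∑ σ : V → Bool with σ j = σ k, N.outerWeight j k σ

/-- The outer weights of all configurations in which `j` and `k` have opposite spins. -/
def opposedSum (N : RTN V E P) (j k : V) : ℝ :=
  ∑ σ : V → Bool with ¬ σ j = σ k, N.outerWeight j k σ

lemma alignedSum_pos (N : RTN V E P) (j k : V) : 0 < N.alignedSum j k :=
  Finset.sum_pos (fun σ _ => N.outerWeight_pos j k σ) ⟨fun _ => true, by simp⟩

/-- The edges joining `j` and `k` are all cut or all uncut, according to whether the two spins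
differ. -/
lemma isingSum_eq (N : RTN V E P) (j k : V) :
    N.isingSum = N.alignedSum j k + (N.bondDimBetween j k : ℝ)⁻¹ * N.opposedSum j k := by
  rw [isingSum, alignedSum, opposedSum, Finset.mul_sum,
    ← Finset.sum_filter_add_sum_filter_not Finset.univ (fun σ : V → Bool => σ j = σ k)]
  congr 1 <;> refine Finset.sum_congr rfl fun σ hσ => ?_ <;>
    rw [Finset.mem_filter] at hσ <;>
    rw [← Fintype.prod_subtype_mul_prod_subtype (fun e => N.ends e = s(j, k))]
  · rw [Finset.prod_eq_one fun e _ => ?_, one_mul]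
    · rfl
    · rw [if_pos]
      rw [e.2]
      simpa using hσ.2
  · refine congrArg₂ _ ?_ rfl
    rw [bondDimBetween, Nat.cast_prod, ← Finset.prod_inv_distrib]
    refine Finset.prod_congr rfl fun e _ => ?_
    rw [if_neg]
    rw [e.2]
    simpa using hσ.2

/-- Composition with `fuseMap` identifies the spin configurations of the fused graph with those
constant on `{j, k}`, and preserves the weight of every surviving edge. -/
lemma fuse_isingSum (N : RTN V E P) {j k : V} (hjk : j ≠ k) :
    (N.fuse hjk).isingSum = N.alignedSum j k := by
  rw [isingSum, alignedSum]
  refine Finset.sum_bij' (fun σ _ => σ ∘ fuseMap hjk) (fun σ _ v => σ v.1) ?_ ?_ ?_ ?_ ?_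
  · intro σ _
    simp [fuseMap, hjk]
  · simp
  · intro σ _
    ext v
    simp [fuseMap, v.2]
  · intro σ hσ
    ext v
    by_cases h : v = k
    · subst h
      simpa [fuseMap] using (Finset.mem_filter.mp hσ).2
    · simp [fuseMap, h]
  · intro σ _
    refine Finset.prod_congr rfl fun e _ => ?_
    simp only [cutWeight, fuse, Sym2.map_map]

/-- Sum `outerWeight_flip_le` over the aligned configurations. Flipping both spins permutes them,
and flipping one maps them bijectively to the opposed ones, so each side appears twice. -/
lemma alignedSum_le (N : RTN V E P) {j k : V} (hjk : j ≠ k) :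
    ((N.outerDim j k j : ℝ) + N.outerDim j k k) * N.alignedSum j k ≤
      ((N.outerDim j k j : ℝ) * N.outerDim j k k + 1) * N.opposedSum j k := by
  have h := Finset.sum_le_sum (s := Finset.univ.filter fun σ : V → Bool => σ j = σ k)
    fun σ _ => N.outerWeight_flip_le hjk σ
  rw [← Finset.mul_sum, ← Finset.mul_sum, Finset.sum_add_distrib, Finset.sum_add_distrib] at h
  have h1 : ∑ σ : V → Bool with σ j = σ k, N.outerWeight j k (flipSpin j (flipSpin k σ)) =
      N.alignedSum j k :=
    Finset.sum_equiv ((flipSpin k).trans (flipSpin j)) (fun σ => by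
      simp [flipSpin_self, flipSpin_of_ne hjk, flipSpin_of_ne hjk.symm]) fun σ _ => rfl
  have h2 : ∑ σ : V → Bool with σ j = σ k, N.outerWeight j k (flipSpin j σ) =
      N.opposedSum j k :=
    Finset.sum_equiv (flipSpin j) (fun σ => by
      simp [flipSpin_self, flipSpin_of_ne hjk.symm]) fun σ _ => rfl
  have h3 : ∑ σ : V → Bool with σ j = σ k, N.outerWeight j k (flipSpin k σ) =
      N.opposedSum j k :=
    Finset.sum_equiv (flipSpin k) (fun σ => by
      simp [flipSpin_self, flipSpin_of_ne hjk]) fun σ _ => rfl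
  rw [h1, h2, h3] at h
  unfold alignedSum at h ⊢
  linarith

lemma one_lt_bondDimBetween (N : RTN V E P) {j k : V} {e : E} (he : N.ends e = s(j, k))
    (hb : 1 < N.bondDim e) : 1 < N.bondDimBetween j k :=
  lt_of_lt_of_le hb (Nat.le_of_dvd (Finset.prod_pos fun e _ => N.bondDim_pos e.1)
    (Finset.dvd_prod_of_mem (fun e : {e : E // N.ends e = s(j, k)} => N.bondDim e.1)
      (Finset.mem_univ ⟨e, he⟩)))

lemma fused_weight_lt {x y B S T : ℝ} (hx : 0 < x) (hy : 0 < y) (hB : 1 < B) (hS : 0 < S)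
    (h : (x + y) * S ≤ (x * y + 1) * T) :
    x * y / (x * y + 1) * S < x * B / (x * B + 1) * (y * B / (y * B + 1)) * (S + B⁻¹ * T) := by
  have hB0 : 0 < B := by linarith
  -- After expansion, `x y B ^ 2 S` cancels and `B` times `h` absorbs `(x + y) B S`; what remains is
  -- `S < B ^ 2 S`, the only place where strictness enters.
  have key : S * ((x * B + 1) * (y * B + 1)) < (x * y + 1) * (B ^ 2 * S + B * T) := by
    have h1 := mul_le_mul_of_nonneg_left h hB0.le
    have h2 : 0 < S * (B ^ 2 - 1) := mul_pos hS (by nlinarith)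
    nlinarith
  have e1 : x * y / (x * y + 1) * S = x * y * S / (x * y + 1) := by ring
  have e2 : x * B / (x * B + 1) * (y * B / (y * B + 1)) * (S + B⁻¹ * T) =
      x * y * (B ^ 2 * S + B * T) / ((x * B + 1) * (y * B + 1)) := by
    field_simp
  rw [e1, e2, div_lt_div_iff₀ (by positivity) (by positivity)]
  have := mul_lt_mul_of_pos_left key (mul_pos hx hy)
  linarith

theorem fuse_partitionFunction_lt (N : RTN V E P) {j k : V} (hjk : j ≠ k)
    (hb : 1 < N.bondDimBetween j k) :
    (∏ v, ((N.fuse hjk).totalDim v : ℝ) / ((N.fuse hjk).totalDim v + 1)) *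
        (N.fuse hjk).isingSum <
      (∏ v, (N.totalDim v : ℝ) / (N.totalDim v + 1)) * N.isingSum := by
  set F : V → ℝ := fun v => (N.totalDim v : ℝ) / (N.totalDim v + 1) with hF
  -- Vertices other than `j` and `k` keep their dimension, so `C` is a common positive factor of
  -- both sides.
  set C : ℝ := ∏ v ∈ (Finset.univ.erase k).erase j, F v with hC
  have hq : ∀ v, 0 < F v := fun v => by
    have : (0 : ℝ) < N.totalDim v := by exact_mod_cast N.totalDim_pos v
    simp only [hF]
    positivity
  have hCpos : 0 < C := Finset.prod_pos fun v _ => hq v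
  have hV : ∏ v, F v = F j * F k * C := by
    rw [← Finset.mul_prod_erase _ _ (Finset.mem_univ k),
      ← Finset.mul_prod_erase _ _ (Finset.mem_erase.mpr ⟨hjk, Finset.mem_univ j⟩)]
    ring
  have hV' : (∏ v, ((N.fuse hjk).totalDim v : ℝ) / ((N.fuse hjk).totalDim v + 1)) =
      (N.outerDim j k j * N.outerDim j k k : ℝ) / (N.outerDim j k j * N.outerDim j k k + 1) * C := by
    rw [← Finset.mul_prod_erase _ _ (Finset.mem_univ (⟨j, hjk⟩ : {v : V // v ≠ k})),
      fuse_totalDim_self]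
    push_cast
    congr 1
    refine Finset.prod_bij (fun v _ => v.1) ?_ ?_ ?_ ?_
    · intro v hv
      simp only [Finset.mem_erase, Finset.mem_univ, and_true] at hv ⊢
      exact ⟨fun h => hv (Subtype.ext h), v.2⟩
    · intro v _ w _ h
      exact Subtype.ext h
    · intro v hv
      simp only [Finset.mem_erase, Finset.mem_univ, and_true] at hv
      exact ⟨⟨v, hv.2⟩, by simpa [Subtype.ext_iff] using hv.1, rfl⟩
    · intro v hv
      simp only [Finset.mem_erase, Finset.mem_univ, and_true] at hv
      rw [N.fuse_totalDim_of_ne hjk v.1 v.2 fun h => hv (Subtype.ext h)]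
  have hFj : F j = N.outerDim j k j * N.bondDimBetween j k /
      (N.outerDim j k j * N.bondDimBetween j k + 1) := by
    simp only [hF, N.totalDim_eq_outerDim_mul j k j (by simp)]
    push_cast
    rfl
  have hFk : F k = N.outerDim j k k * N.bondDimBetween j k /
      (N.outerDim j k k * N.bondDimBetween j k + 1) := by
    simp only [hF, N.totalDim_eq_outerDim_mul j k k (by simp)]
    push_cast
    rfl
  rw [hV, hV', fuse_isingSum, N.isingSum_eq j k, hFj, hFk]
  have hx : (0 : ℝ) < N.outerDim j k j := by exact_mod_cast N.outerDim_pos j k j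
  have hy : (0 : ℝ) < N.outerDim j k k := by exact_mod_cast N.outerDim_pos j k k
  have hB : (1 : ℝ) < N.bondDimBetween j k := by exact_mod_cast hb
  have := mul_lt_mul_of_pos_right
    (fused_weight_lt hx hy hB (N.alignedSum_pos j k) (N.alignedSum_le hjk)) hCpos
  linarith

end Fusion

end RTN

end

/-! ### Growth of the effective dimension. -/

theorem mainTheorem2 {V E P : Type*} [Fintype V] [DecidableEq V] [Fintype E] [DecidableEq E]
    [Fintype P] [DecidableEq P] (N : RTN V E P) (j k : V) (hjk : j ≠ k)
    (e : E) (he : N.ends e = s(j, k)) (hb : 1 < N.bondDim e) :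
    -- the fused network has one vertex less, and has lost exactly the edges joining `j` and `k`
    Fintype.card {v : V // v ≠ k} + 1 = Fintype.card V ∧
    Fintype.card {e : E // N.ends e ≠ s(j, k)} + Fintype.card {e : E // N.ends e = s(j, k)} =
      Fintype.card E ∧
    -- the dimension of the fused tensor
    (N.fuse hjk).totalDim ⟨j, hjk⟩ * N.bondDimBetween j k ^ 2 = N.totalDim j * N.totalDim k ∧
    -- the effective dimension grows
    ∀ (Φ : EuclideanSpace ℂ (∀ v, Fin (N.logDim v)))
      (φ : EuclideanSpace ℂ (P → Fin N.physDim))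
      (ref : ∀ v, EuclideanSpace ℂ (N.Legs v))
      (Φ' : EuclideanSpace ℂ (∀ v, Fin ((N.fuse hjk).logDim v)))
      (φ' : EuclideanSpace ℂ (P → Fin (N.fuse hjk).physDim))
      (ref' : ∀ v, EuclideanSpace ℂ ((N.fuse hjk).Legs v)),
      IsUnentangled Φ → IsUnentangled φ → (∀ v, ‖ref v‖ = 1) →
      IsUnentangled Φ' → IsUnentangled φ' → (∀ v, ‖ref' v‖ = 1) →
      0 < N.effDim Φ φ ref ∧ N.effDim Φ φ ref < (N.fuse hjk).effDim Φ' φ' ref' := by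
  refine ⟨?_, ?_, ?_, ?_⟩
  · rw [← Fintype.card_subtype_eq k, add_comm, ← Fintype.card_sum]
    exact Fintype.card_congr (Equiv.sumCompl fun v => v = k)
  · rw [add_comm, ← Fintype.card_sum]
    exact Fintype.card_congr (Equiv.sumCompl fun e => N.ends e = s(j, k))
  · rw [N.fuse_totalDim_self hjk, N.totalDim_eq_outerDim_mul j k j (by simp),
      N.totalDim_eq_outerDim_mul j k k (by simp)]
    ring
  · intro Φ φ ref Φ' φ' ref' hΦ hφ href hΦ' hφ' href'
    rw [N.effDim_eq Φ φ ref hΦ hφ href, (N.fuse hjk).effDim_eq Φ' φ' ref' hΦ' hφ' href']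
    have ha : (0 : ℝ) < (N.physDim : ℝ) ^ Fintype.card P := by
      have : (0 : ℝ) < N.physDim := by exact_mod_cast N.physDim_pos
      positivity
    have hpos : ∀ {W F : Type _} [Fintype W] [DecidableEq W] [Fintype F] [DecidableEq F]
        (M : RTN W F P), 0 < (∏ v, (M.totalDim v : ℝ) / (M.totalDim v + 1)) * M.isingSum := by
      intro W F _ _ _ _ M
      refine mul_pos (Finset.prod_pos fun v _ => ?_) M.isingSum_pos
      have : (0 : ℝ) < M.totalDim v := by exact_mod_cast M.totalDim_pos v
      positivity
    exact ⟨div_pos ha (hpos N), div_lt_div_of_pos_left ha (hpos (N.fuse hjk))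
      (N.fuse_partitionFunction_lt hjk (N.one_lt_bondDimBetween he hb))⟩
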